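/- Let $\mathcal V$ be a $3$-dimensional complex vector space, and fix a basis $b_0,b_1,b_2$ of $\mathcal V$ (indices modulo $3$). Let $\mathrm{Sym}^2\mathcal V\subset\mathcal V\otimes\mathcal V$ be the space of symmetric tensors, let $R=\mathbb C[\mathrm{Sym}^2\mathcal V]$, let $\gamma\colon R\otimes\mathcal V^\vee\to R\otimes\mathcal V$ be the tautological map $1\otimes\varphi\mapsto(\alpha\mapsto\alpha(\varphi))$, let $M$ be its (symmetric) matrix in the given basis and its dual basis, $M^c$ the matrix of cofactors of $M$, and $N=\operatorname{coker}\gamma$. Let $\xi_k\in N$ be the class of $1\otimes b_k$. The $R$-module $R/(\det M)\oplus N$ is a commutative ring with the product $(r,n)(r',n')=(rr'+m(n,n'),\,rn'+r'n)$, where $m\colon N\times N\to R/(\det M)$ is the $R$-bilinear map with $m(\xi_i,\xi_j)=M^c_{ij}$. Put $X(\mathcal V)=\operatorname{Spec}(R/(\det M)\oplus N)$ and $Y(\mathcal V)=\operatorname{Spec}(R/(\det M))$, let $f\colon X(\mathcal V)\to Y(\mathcal V)$ be the structure map, and let $\phi$ be the covering involution, given by $(r,n)\mapsto(r,-n)$.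 Let $(\mathcal V\otimes\mathcal V)_1=\{\mu\in\mathcal V\otimes\mathcal V\mid \operatorname{rk}\mu\le 1\}$, with its reduced structure, and let $\sigma\colon(\mathcal V\otimes\mathcal V)_1\to Y(\mathcal V)$, $\sigma(\mu)=\mu+\mu^t$. Then: 1. $Y(\mathcal V)$ is the reduced variety $\{\alpha\in\mathrm{Sym}^2\mathcal V\mid\operatorname{rk}\alpha<3\}$; that is, the ideal of regular functions vanishing on this set is $(\det M)$. 2. There is an isomorphism of $\mathbb C$-schemes $\tau\colon(\mathcal V\otimes\mathcal V)_1\to X(\mathcal V)$ such that $f\circ\tau=\sigma$ and $\phi\circ\tau=\tau\circ(\,\cdot\,)^t$, i.e. $\phi(\tau(\mu))=\tau(\mu^t)$. It can be chosen to be $\mu\mapsto(\mu+\mu^t,\ \sqrt{-1}\,(\mu-\mu^t))$, where $\mu-\mu^t\in\bigwedge^2\mathcal V\cong\mathcal V^\vee\otimes\bigwedge^3\mathcal V\cong\mathcal V^\vee$; explicitly $\tau^*\xi_k=\sqrt{-1}\,(\mu_{k+1,k+2}-\mu_{k+2,k+1})$, where $\mu=\sum\mu_{ij}\,b_i\otimes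 b_j$. 3. With this $\tau$, the singular locus of $X(\mathcal V)$ is the single point $\tau(0)$, and as a set it equals $f^{-1}(0)$. -/

import Mathlib

open TensorProduct Module AlgebraicGeometry CategoryTheory

noncomputable section

/-! ### The double cover attached to a symmetric map of free modules of rank 3 -/

/-- A homomorphism `map : U₁ → U₀` of free modules of rank `3`, with bases in which its matrix is
symmetric. (A symmetric map `γ : U^∨ → U` gives such data for any basis of `U` and the dual basis
of `U^∨`.) -/
structure SymmPresentation (R U₁ U₀ : Type*) [CommRing R] [AddCommGroup U₁] [Module R U₁]
    [AddCommGroup U₀] [Module R U₀] where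
  srcBasis : Basis (Fin 3) R U₁
  tgtBasis : Basis (Fin 3) R U₀
  map : U₁ →ₗ[R] U₀
  isSymm : (LinearMap.toMatrix srcBasis tgtBasis map).IsSymm

namespace SymmPresentation

variable {R U₁ U₀ : Type*} [CommRing R] [AddCommGroup U₁] [Module R U₁]
  [AddCommGroup U₀] [Module R U₀] (S : SymmPresentation R U₁ U₀)

/-- The matrix `M` of the map. -/
def mat : Matrix (Fin 3) (Fin 3) R := LinearMap.toMatrix S.srcBasis S.tgtBasis S.map

/-- The ideal `(det M)`, which is the Fitting ideal of the cokernel. -/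
def fitt : Ideal R := Ideal.span {S.mat.det}

/-- The cokernel `N` of the map. -/
def N : Type _ := U₀ ⧸ LinearMap.range S.map

instance : AddCommGroup S.N := inferInstanceAs (AddCommGroup (U₀ ⧸ LinearMap.range S.map))
instance : Module R S.N := inferInstanceAs (Module R (U₀ ⧸ LinearMap.range S.map))

/-- The projection `U₀ → N`. -/
def proj : U₀ →ₗ[R] S.N := (LinearMap.range S.map).mkQ

lemma proj_surjective : Function.Surjective S.proj := Submodule.mkQ_surjective _

lemma proj_map (y : U₁) : S.proj (S.map y) = 0 :=
  (Submodule.Quotient.mk_eq_zero _).2 ⟨y, rfl⟩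

lemma mat_isSymm : S.mat.transpose = S.mat := S.isSymm

lemma repr_map (y : U₁) : ⇑(S.tgtBasis.repr (S.map y)) = S.mat.mulVec (S.srcBasis.repr y) :=
  (LinearMap.toMatrix_mulVec_repr S.srcBasis S.tgtBasis S.map y).symm

lemma proj_eq_zero (u : U₀) (z : Fin 3 → R) (h : ⇑(S.tgtBasis.repr u) = S.mat.mulVec z) :
    S.proj u = 0 := by
  have : u = S.map (S.srcBasis.equivFun.symm z) := by
    apply S.tgtBasis.repr.injective
    ext i
    rw [S.repr_map, h]
    congr 1
    have := S.srcBasis.equivFun.apply_symm_apply z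
    rw [Basis.equivFun_apply] at this
    rw [this]
  rw [this, S.proj_map]

/-- The form `(u, u') ↦ u^T M^c u'` on `U₀`, where `M^c` is the (symmetric) matrix of cofactors. -/
def cofactorForm : U₀ →ₗ[R] U₀ →ₗ[R] R :=
  Matrix.toLinearMap₂ S.tgtBasis S.tgtBasis S.mat.adjugate

lemma cofactorForm_apply (u v : U₀) : S.cofactorForm u v =
    S.tgtBasis.repr u ⬝ᵥ S.mat.adjugate.mulVec (S.tgtBasis.repr v) := by
  simp only [cofactorForm, Matrix.toLinearMap₂_apply, dotProduct, Matrix.mulVec, Finset.mul_sum,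
    smul_eq_mul]
  exact Finset.sum_congr rfl fun i _ => Finset.sum_congr rfl fun j _ => by ring

lemma cofactorForm_comm (u v : U₀) : S.cofactorForm u v = S.cofactorForm v u := by
  have h : S.mat.adjugate.transpose = S.mat.adjugate := by
    rw [Matrix.adjugate_transpose, S.mat_isSymm]
  rw [cofactorForm_apply, cofactorForm_apply, Matrix.dotProduct_mulVec, dotProduct_comm,
    ← Matrix.mulVec_transpose, h]

lemma cofactorForm_map (u : U₀) (y : U₁) : S.cofactorForm u (S.map y) ∈ S.fitt := by
  rw [cofactorForm_apply, repr_map, Matrix.mulVec_mulVec, Matrix.adjugate_mul,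
    Matrix.smul_mulVec, dotProduct_smul, smul_eq_mul]
  exact Ideal.mul_mem_right _ _ (Ideal.subset_span rfl)

/-- The form on `U₀` modulo `det M`. -/
def cofactorFormMod : U₀ →ₗ[R] U₀ →ₗ[R] R ⧸ S.fitt :=
  S.cofactorForm.compr₂ (Submodule.mkQ S.fitt)

lemma cofactorFormMod_map (u : U₀) (y : U₁) : S.cofactorFormMod u (S.map y) = 0 :=
  Ideal.Quotient.eq_zero_iff_mem.2 (S.cofactorForm_map u y)

lemma cofactorFormMod_comm (u v : U₀) : S.cofactorFormMod u v = S.cofactorFormMod v u :=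
  congrArg (Submodule.mkQ S.fitt) (S.cofactorForm_comm u v)

/-- The multiplication `N × N → R/(det M)` with `(a_i, a_j) ↦ M^c_{ij}` on the classes of the
basis vectors. -/
def pairing : S.N →ₗ[R] S.N →ₗ[R] R ⧸ S.fitt :=
  (LinearMap.range S.map).liftQ
    (((LinearMap.range S.map).liftQ S.cofactorFormMod (by
      rintro _ ⟨y, rfl⟩
      ext u
      rw [S.cofactorFormMod_comm, S.cofactorFormMod_map, LinearMap.zero_apply])).flip) (by
      rintro _ ⟨y, rfl⟩
      refine LinearMap.ext fun n => ?_
      obtain ⟨u, rfl⟩ := Submodule.mkQ_surjective _ n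
      exact S.cofactorFormMod_map u y)

lemma pairing_proj (u v : U₀) :
    S.pairing (S.proj u) (S.proj v) = Ideal.Quotient.mk S.fitt (S.cofactorForm u v) :=
  S.cofactorFormMod_comm v u

/-- The multiplication is the one induced by the extension class: a lift `y ∈ U₁ = U₀^∨` of
`m(u, ·)` is determined by `γ(y) = (det M) u`. -/
lemma pairing_proj_of_map_eq (hdet : S.mat.det ∈ nonZeroDivisors R) (u v : U₀) (y : U₁)
    (h : S.map y = S.mat.det • u) : S.pairing (S.proj u) (S.proj v) =
      Ideal.Quotient.mk S.fitt (S.srcBasis.repr y ⬝ᵥ S.tgtBasis.repr v) := by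
  have h1 : S.mat.mulVec (S.srcBasis.repr y) = S.mat.det • ⇑(S.tgtBasis.repr u) := by
    rw [← repr_map, h, map_smul]; rfl
  have h2 := congrArg S.mat.adjugate.mulVec h1
  rw [Matrix.mulVec_mulVec, Matrix.adjugate_mul, Matrix.smul_mulVec, Matrix.one_mulVec,
    Matrix.mulVec_smul] at h2
  have h3 : ⇑(S.srcBasis.repr y) = S.mat.adjugate.mulVec (S.tgtBasis.repr u) := by
    funext i
    have := congrFun h2 i
    simp only [Pi.smul_apply, smul_eq_mul] at this
    exact (mul_cancel_left_mem_nonZeroDivisors hdet).1 this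
  rw [pairing_proj, cofactorForm_comm, cofactorForm_apply, h3, dotProduct_comm]

lemma pairing_comm (n n' : S.N) : S.pairing n n' = S.pairing n' n := by
  obtain ⟨u, rfl⟩ := S.proj_surjective n
  obtain ⟨v, rfl⟩ := S.proj_surjective n'
  rw [pairing_proj, pairing_proj, cofactorForm_comm]

lemma isTorsion : IsTorsionBySet R S.N S.fitt := by
  intro n ⟨r, hr⟩
  obtain ⟨c, rfl⟩ := Ideal.mem_span_singleton'.1 hr
  obtain ⟨u, rfl⟩ := S.proj_surjective n
  change (c * S.mat.det) • S.proj u = 0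
  rw [← map_smul]
  refine S.proj_eq_zero _ (c • S.mat.adjugate.mulVec (S.tgtBasis.repr u)) ?_
  rw [Matrix.mulVec_smul, Matrix.mulVec_mulVec, Matrix.mul_adjugate, Matrix.smul_mulVec,
    Matrix.one_mulVec, smul_smul, map_smul]
  rfl

/-- `N` is a module over `R/(det M)`. -/
instance : Module (R ⧸ S.fitt) S.N := S.isTorsion.module

lemma mk_smul (r : R) (n : S.N) : Ideal.Quotient.mk S.fitt r • n = r • n := rfl

lemma pairing_smul (r : R ⧸ S.fitt) (n n' : S.N) :
    S.pairing n (r • n') = r * S.pairing n n' := by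
  obtain ⟨r, rfl⟩ := Ideal.Quotient.mk_surjective r
  rw [mk_smul, map_smul]
  rfl

lemma pairing_smul_left (r : R ⧸ S.fitt) (n n' : S.N) :
    S.pairing (r • n) n' = r * S.pairing n n' := by
  rw [pairing_comm, pairing_smul, pairing_comm]

lemma pairing_assoc (n n' n'' : S.N) :
    S.pairing n n' • n'' = S.pairing n' n'' • n := by
  obtain ⟨u, rfl⟩ := S.proj_surjective n
  obtain ⟨v, rfl⟩ := S.proj_surjective n'
  obtain ⟨w, rfl⟩ := S.proj_surjective n''
  rw [pairing_proj, pairing_proj, mk_smul, mk_smul, ← map_smul, ← map_smul, ← sub_eq_zero,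
    ← map_sub]
  have hs : ∀ i j, S.mat i j = S.mat j i := fun i j => congrFun (congrFun S.mat_isSymm j) i
  set a := S.tgtBasis.repr u with ha
  set c := S.tgtBasis.repr v with hc
  set d := S.tgtBasis.repr w with hd
  refine S.proj_eq_zero _ (crossProduct (S.mat.mulVec (crossProduct a d)) c) ?_
  have hM : S.mat.adjugate = !![S.mat 1 1 * S.mat 2 2 - S.mat 1 2 * S.mat 2 1,
      -(S.mat 0 1 * S.mat 2 2) + S.mat 0 2 * S.mat 2 1,
      S.mat 0 1 * S.mat 1 2 - S.mat 0 2 * S.mat 1 1;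
      -(S.mat 1 0 * S.mat 2 2) + S.mat 1 2 * S.mat 2 0,
      S.mat 0 0 * S.mat 2 2 - S.mat 0 2 * S.mat 2 0,
      -(S.mat 0 0 * S.mat 1 2) + S.mat 0 2 * S.mat 1 0;
      S.mat 1 0 * S.mat 2 1 - S.mat 1 1 * S.mat 2 0,
      -(S.mat 0 0 * S.mat 2 1) + S.mat 0 1 * S.mat 2 0,
      S.mat 0 0 * S.mat 1 1 - S.mat 0 1 * S.mat 1 0] := Matrix.adjugate_fin_three _
  funext i
  rw [map_sub, map_smul, map_smul, Finsupp.sub_apply, Finsupp.smul_apply, Finsupp.smul_apply,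
    cofactorForm_apply, cofactorForm_apply, ← ha, ← hc, ← hd, hM]
  have h10 := hs 1 0
  have h20 := hs 2 0
  have h21 := hs 2 1
  fin_cases i <;>
  simp [crossProduct, Matrix.mulVec, dotProduct, Fin.sum_univ_three, h10, h20, h21] <;> ring

/-- The coordinate ring `R/(det M) ⊕ N` of the double cover. -/
@[ext]
structure CoverRing where
  fst : R ⧸ S.fitt
  snd : S.N

namespace CoverRing

/-- `R/(det M) ⊕ N` as a direct sum. -/
def toProd : S.CoverRing ≃ (R ⧸ S.fitt) × S.N where
  toFun x := (x.fst, x.snd)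
  invFun x := ⟨x.1, x.2⟩

instance : AddCommGroup S.CoverRing := (toProd S).addCommGroup

/-- `(r, n) (r', n') = (r r' + m(n, n'), r n' + r' n)`. -/
instance : Mul S.CoverRing :=
  ⟨fun x y => ⟨x.1 * y.1 + S.pairing x.2 y.2, x.1 • y.2 + y.1 • x.2⟩⟩

instance : One S.CoverRing := ⟨⟨1, 0⟩⟩

variable {S}

lemma fst_mul (x y : S.CoverRing) : (x * y).1 = x.1 * y.1 + S.pairing x.2 y.2 := rfl
lemma snd_mul (x y : S.CoverRing) : (x * y).2 = x.1 • y.2 + y.1 • x.2 := rfl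
lemma fst_add (x y : S.CoverRing) : (x + y).1 = x.1 + y.1 := rfl
lemma snd_add (x y : S.CoverRing) : (x + y).2 = x.2 + y.2 := rfl
lemma fst_one : (1 : S.CoverRing).1 = 1 := rfl
lemma snd_one : (1 : S.CoverRing).2 = 0 := rfl
lemma fst_zero : (0 : S.CoverRing).1 = 0 := rfl
lemma snd_zero : (0 : S.CoverRing).2 = 0 := rfl

lemma mul_comm' (x y : S.CoverRing) : x * y = y * x := by
  ext
  · rw [fst_mul, fst_mul, mul_comm, pairing_comm]
  · rw [snd_mul, snd_mul, add_comm]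

lemma left_distrib' (x y z : S.CoverRing) : x * (y + z) = x * y + x * z := by
  ext
  · simp only [fst_mul, fst_add, snd_add, map_add]; ring
  · simp only [snd_mul, fst_add, snd_add, smul_add, add_smul]; abel

lemma one_mul' (x : S.CoverRing) : 1 * x = x := by
  ext
  · simp only [fst_mul, fst_one, snd_one, map_zero, LinearMap.zero_apply, one_mul, add_zero]
  · simp only [snd_mul, fst_one, snd_one, one_smul, smul_zero, add_zero]

lemma zero_mul' (x : S.CoverRing) : 0 * x = 0 := by
  ext
  · simp only [fst_mul, fst_zero, snd_zero, map_zero, LinearMap.zero_apply, zero_mul, add_zero]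
  · simp only [snd_mul, fst_zero, snd_zero, zero_smul, smul_zero, add_zero]

lemma mul_assoc' (x y z : S.CoverRing) : x * y * z = x * (y * z) := by
  ext
  · simp only [fst_mul, snd_mul, map_add, LinearMap.add_apply, pairing_smul, pairing_smul_left]
    ring
  · simp only [fst_mul, snd_mul, add_smul, smul_add, smul_smul]
    rw [S.pairing_assoc x.2 y.2 z.2, mul_comm z.1 x.1, mul_comm z.1 y.1]
    abel

instance : CommRing S.CoverRing where
  __ := (inferInstance : AddCommGroup S.CoverRing)
  mul_assoc := mul_assoc'
  one_mul := one_mul'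
  mul_one x := by rw [mul_comm', one_mul']
  left_distrib := left_distrib'
  right_distrib x y z := by rw [mul_comm', left_distrib', mul_comm' z, mul_comm' z]
  zero_mul := zero_mul'
  mul_zero x := by rw [mul_comm', zero_mul']
  mul_comm := mul_comm'

variable (S)

/-- The structure map `R/(det M) → R/(det M) ⊕ N`. -/
def structureHom : (R ⧸ S.fitt) →+* S.CoverRing where
  toFun r := ⟨r, 0⟩
  map_one' := rfl
  map_zero' := rfl
  map_add' r s := by
    ext
    · rfl
    · simp [snd_add]
  map_mul' r s := by
    ext
    · simp [fst_mul]
    · simp [snd_mul]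

instance [Algebra ℂ R] : Algebra ℂ S.CoverRing :=
  ((structureHom S).comp ((Ideal.Quotient.mk S.fitt).comp (algebraMap ℂ R))).toAlgebra

/-- The inclusion of `N`. -/
def ofN (n : S.N) : S.CoverRing := ⟨0, n⟩

/-- The involution `(r, n) ↦ (r, -n)`. -/
def involution : S.CoverRing →+* S.CoverRing where
  toFun x := ⟨x.1, -x.2⟩
  map_one' := by ext <;> simp [fst_one, snd_one]
  map_zero' := by ext <;> simp [fst_zero, snd_zero]
  map_add' x y := by
    ext
    · rfl
    · simp [snd_add, add_comm]
  map_mul' x y := by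
    ext
    · simp [fst_mul]
    · simp [snd_mul, add_comm]

end CoverRing

end SymmPresentation

/-! ### Regular functions on a vector space -/

section Regular

variable (W : Type*) [AddCommGroup W] [Module ℂ W]

/-- The ring `ℂ[W]` of regular functions on a finite-dimensional space `W`. -/
abbrev Reg : Type _ := SymmetricAlgebra ℂ (Dual ℂ W)

variable {W}

/-- Evaluation of regular functions at a point. -/
def evalAt (w : W) : Reg W →ₐ[ℂ] ℂ := SymmetricAlgebra.lift (Dual.eval ℂ W w)

/-- The ideal of regular functions that vanish on a set. -/
def idealOf (Z : Set W) : Ideal (Reg W) := ⨅ w ∈ Z, RingHom.ker (evalAt w)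

lemma mem_idealOf {Z : Set W} {p : Reg W} : p ∈ idealOf Z ↔ ∀ w ∈ Z, evalAt w p = 0 := by
  simp [idealOf, RingHom.mem_ker]

/-- Pull-back of regular functions along a linear map. -/
def pullback {W' : Type*} [AddCommGroup W'] [Module ℂ W'] (g : W →ₗ[ℂ] W') : Reg W' →ₐ[ℂ] Reg W :=
  SymmetricAlgebra.lift (SymmetricAlgebra.ι ℂ (Dual ℂ W) ∘ₗ g.dualMap)

lemma evalAt_pullback {W' : Type*} [AddCommGroup W'] [Module ℂ W'] (g : W →ₗ[ℂ] W') (w : W)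
    (p : Reg W') : evalAt w (pullback g p) = evalAt (g w) p := by
  have : (evalAt w).comp (pullback g) = evalAt (g w) := by
    apply SymmetricAlgebra.algHom_ext
    ext l
    simp [evalAt, pullback]
  exact DFunLike.congr_fun this p

end Regular

/-! ### Tensors of order two -/

section Tensors

variable {V : Type*} [AddCommGroup V] [Module ℂ V]

/-- A tensor in `V ⊗ V` as a linear map `V^∨ → V`: `v ⊗ w` is `φ ↦ φ(w) v`. -/
def toHom : V ⊗[ℂ] V →ₗ[ℂ] (Dual ℂ V →ₗ[ℂ] V) :=
  dualTensorHom ℂ (Dual ℂ V) V ∘ₗ TensorProduct.map (Dual.eval ℂ V) LinearMap.id ∘ₗ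
    (TensorProduct.comm ℂ V V).toLinearMap

lemma toHom_tmul (v w : V) (φ : Dual ℂ V) : toHom (v ⊗ₜ[ℂ] w) φ = φ w • v := by
  simp [toHom]

/-- The rank of a tensor. -/
def tensorRank (μ : V ⊗[ℂ] V) : ℕ := finrank ℂ (LinearMap.range (toHom μ))

/-- The transpose `μ^t`. -/
def transposeMap : V ⊗[ℂ] V →ₗ[ℂ] V ⊗[ℂ] V := (TensorProduct.comm ℂ V V).toLinearMap

lemma transposeMap_transposeMap (μ : V ⊗[ℂ] V) : transposeMap (transposeMap μ) = μ := by
  induction μ with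
  | zero => simp
  | tmul v w => simp [transposeMap]
  | add x y hx hy => rw [map_add, map_add, hx, hy]

lemma toHom_transposeMap (μ : V ⊗[ℂ] V) (φ ψ : Dual ℂ V) :
    ψ (toHom (transposeMap μ) φ) = φ (toHom μ ψ) := by
  induction μ with
  | zero => simp
  | tmul v w => simp [transposeMap, toHom_tmul, mul_comm]
  | add x y hx hy => simp [map_add, hx, hy]

variable (V) in
/-- `Sym²V`, the symmetric tensors in `V ⊗ V`. -/
def Sym2Tensor : Submodule ℂ (V ⊗[ℂ] V) := LinearMap.eqLocus transposeMap LinearMap.id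

lemma mem_sym2Tensor {α : V ⊗[ℂ] V} : α ∈ Sym2Tensor V ↔ transposeMap α = α := Iff.rfl

/-- The linear map `V ⊗ V → Sym²V`, `μ ↦ μ + μ^t`. -/
def symmetrize : V ⊗[ℂ] V →ₗ[ℂ] Sym2Tensor V :=
  (LinearMap.id + transposeMap).codRestrict (Sym2Tensor V) fun μ => by
    simp [mem_sym2Tensor, transposeMap_transposeMap, add_comm]

variable (V) in
/-- The cone `(V ⊗ V)_1` of tensors of rank at most one. -/
def rankOneCone : Set (V ⊗[ℂ] V) := {μ | tensorRank μ ≤ 1}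

variable (V) in
/-- The set of degenerate symmetric tensors. -/
def degenerate : Set (Sym2Tensor V) := {α | tensorRank (α : V ⊗[ℂ] V) < 3}

lemma zero_mem_rankOneCone : (0 : V ⊗[ℂ] V) ∈ rankOneCone V := by
  change finrank ℂ (LinearMap.range (toHom (0 : V ⊗[ℂ] V))) ≤ 1
  rw [map_zero, LinearMap.range_zero, finrank_bot]
  exact Nat.zero_le 1

lemma zero_mem_degenerate : (0 : Sym2Tensor V) ∈ degenerate V := by
  change finrank ℂ (LinearMap.range (toHom (0 : V ⊗[ℂ] V))) < 3
  rw [map_zero, LinearMap.range_zero, finrank_bot]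
  exact Nat.zero_lt_succ 2

lemma tensorRank_transposeMap [FiniteDimensional ℂ V] (μ : V ⊗[ℂ] V) :
    tensorRank (transposeMap μ) = tensorRank μ := by
  have h : (toHom μ).dualMap = Dual.eval ℂ V ∘ₗ toHom (transposeMap μ) := by
    ext φ ψ
    simp [toHom_transposeMap]
  rw [tensorRank, tensorRank, ← LinearMap.finrank_range_dualMap_eq_finrank_range (toHom μ), h,
    LinearMap.range_comp]
  exact (LinearEquiv.finrank_map_eq (evalEquiv ℂ V) _).symm

lemma tensorRank_symmetrize_lt [FiniteDimensional ℂ V] {μ : V ⊗[ℂ] V} (h : μ ∈ rankOneCone V) :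
    symmetrize μ ∈ degenerate V := by
  have h1 : tensorRank μ ≤ 1 := h
  have h2 : tensorRank (transposeMap μ) ≤ 1 := (tensorRank_transposeMap μ).trans_le h1
  have h3 : LinearMap.range (toHom (symmetrize μ : V ⊗[ℂ] V)) ≤
      LinearMap.range (toHom μ) ⊔ LinearMap.range (toHom (transposeMap μ)) := by
    rintro _ ⟨φ, rfl⟩
    have : (symmetrize μ : V ⊗[ℂ] V) = μ + transposeMap μ := rfl
    rw [this, map_add, LinearMap.add_apply]
    exact Submodule.add_mem_sup ⟨φ, rfl⟩ ⟨φ, rfl⟩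
  have h4 := Submodule.finrank_mono h3
  have h5 := Submodule.finrank_add_le_finrank_add_finrank (LinearMap.range (toHom μ))
    (LinearMap.range (toHom (transposeMap μ)))
  change tensorRank (symmetrize μ : V ⊗[ℂ] V) < 3
  unfold tensorRank at *
  omega

end Tensors

/-! ### The universal double cover -/

section Universal

variable {V : Type*} [AddCommGroup V] [Module ℂ V] [FiniteDimensional ℂ V]

variable (V) in
/-- The ring of regular functions on `Sym²V`. -/
abbrev RegSym : Type _ := Reg (Sym2Tensor V)

/-- A linear map `Sym²V → V` as a `V`-valued regular map on `Sym²V`, i.e. an element of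
`ℂ[Sym²V] ⊗ V`. -/
def linearRegular : (Sym2Tensor V →ₗ[ℂ] V) →ₗ[ℂ] RegSym V ⊗[ℂ] V :=
  (SymmetricAlgebra.ι ℂ (Dual ℂ (Sym2Tensor V))).rTensor V ∘ₗ
    (dualTensorHomEquiv ℂ (Sym2Tensor V) V).symm.toLinearMap

variable (V) in
/-- The tautological map `γ : ℂ[Sym²V] ⊗ V^∨ → ℂ[Sym²V] ⊗ V`: it sends `1 ⊗ φ` to the `V`-valued
map `α ↦ α(φ)`. -/
def tautological : RegSym V ⊗[ℂ] Dual ℂ V →ₗ[RegSym V] RegSym V ⊗[ℂ] V :=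
  (linearRegular ∘ₗ (toHom ∘ₗ (Sym2Tensor V).subtype).flip).liftBaseChange (RegSym V)

lemma repr_linearRegular (b : Basis (Fin 3) ℂ V) (L : Sym2Tensor V →ₗ[ℂ] V) (i : Fin 3) :
    (b.baseChange (RegSym V)).repr (linearRegular L) i =
      SymmetricAlgebra.ι ℂ (Dual ℂ (Sym2Tensor V)) (b.coord i ∘ₗ L) := by
  obtain ⟨t, rfl⟩ := (dualTensorHomEquiv ℂ (Sym2Tensor V) V).surjective L
  simp only [linearRegular, LinearMap.comp_apply, LinearEquiv.coe_coe,
    LinearEquiv.symm_apply_apply]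
  induction t with
  | zero => simp
  | tmul l v =>
    have : b.coord i ∘ₗ (dualTensorHomEquiv ℂ (Sym2Tensor V) V) (l ⊗ₜ[ℂ] v) =
        b.repr v i • l := by
      ext α
      simp [mul_comm]
    rw [this]
    simp
  | add x y hx hy => simp only [map_add, Finsupp.add_apply, hx, hy, LinearMap.comp_add]

lemma tautological_matrix (b : Basis (Fin 3) ℂ V) (i j : Fin 3) :
    LinearMap.toMatrix (b.dualBasis.baseChange (RegSym V)) (b.baseChange (RegSym V))
      (tautological V) i j = SymmetricAlgebra.ι ℂ (Dual ℂ (Sym2Tensor V))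
        (b.coord i ∘ₗ (toHom ∘ₗ (Sym2Tensor V).subtype).flip (b.coord j)) := by
  rw [LinearMap.toMatrix_apply, Basis.baseChange_apply, tautological,
    LinearMap.liftBaseChange_tmul, one_smul, LinearMap.comp_apply, repr_linearRegular]
  simp

/-- The tautological map, with the bases induced by a basis of `V`. -/
def universalPresentation (b : Basis (Fin 3) ℂ V) :
    SymmPresentation (RegSym V) (RegSym V ⊗[ℂ] Dual ℂ V) (RegSym V ⊗[ℂ] V) where
  srcBasis := b.dualBasis.baseChange (RegSym V)
  tgtBasis := b.baseChange (RegSym V)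
  map := tautological V
  isSymm := by
    ext i j
    rw [Matrix.transpose_apply, tautological_matrix, tautological_matrix]
    congr 1
    ext α
    have := toHom_transposeMap (α : V ⊗[ℂ] V) (b.coord i) (b.coord j)
    rw [mem_sym2Tensor.1 α.2] at this
    simpa using this

lemma evalAt_det (b : Basis (Fin 3) ℂ V) (α : Sym2Tensor V) :
    evalAt α (universalPresentation b).mat.det =
      (LinearMap.toMatrix b.dualBasis b (toHom (α : V ⊗[ℂ] V))).det := by
  rw [AlgHom.map_det]
  congr 1
  ext i j
  have : (universalPresentation b).mat i j = _ := tautological_matrix b i j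
  rw [AlgHom.mapMatrix_apply, Matrix.map_apply, this, LinearMap.toMatrix_apply, evalAt,
    SymmetricAlgebra.lift_ι_apply]
  simp

lemma fitt_le_ker_evalAt (b : Basis (Fin 3) ℂ V) {α : Sym2Tensor V} (hα : α ∈ degenerate V)
    (p : RegSym V) (hp : p ∈ (universalPresentation b).fitt) : evalAt α p = 0 := by
  obtain ⟨c, rfl⟩ := Ideal.mem_span_singleton'.1 hp
  rw [map_mul, evalAt_det]
  by_contra hne
  have hdet : (LinearMap.toMatrix b.dualBasis b (toHom (α : V ⊗[ℂ] V))).det ≠ 0 :=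
    right_ne_zero_of_mul hne
  have hr : tensorRank (α : V ⊗[ℂ] V) = 3 := by
    have hb : finrank ℂ V = 3 := by rw [finrank_eq_card_basis b]; rfl
    rw [tensorRank, ← hb]
    rw [LinearMap.range_eq_top.2, finrank_top]
    exact (LinearEquiv.ofIsUnitDet (v := b.dualBasis) (v' := b)
      (f := toHom (α : V ⊗[ℂ] V)) (isUnit_iff_ne_zero.2 hdet)).surjective
  have : tensorRank (α : V ⊗[ℂ] V) < 3 := hα
  omega

/-- The coordinate ring of `Y(V)`, namely `ℂ[Sym²V]/(det M)`. -/
abbrev YRing (b : Basis (Fin 3) ℂ V) : Type _ := RegSym V ⧸ (universalPresentation b).fitt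

/-- The coordinate ring of `X(V)`. -/
abbrev XRing (b : Basis (Fin 3) ℂ V) : Type _ := (universalPresentation b).CoverRing

variable (V) in
/-- The coordinate ring of the (reduced) variety `(V ⊗ V)_1`. -/
abbrev ConeRing : Type _ := Reg (V ⊗[ℂ] V) ⧸ idealOf (rankOneCone V)

/-- The scheme `Y(V)`. -/
abbrev YScheme (b : Basis (Fin 3) ℂ V) : Scheme := Spec (CommRingCat.of (YRing b))

/-- The scheme `X(V)`. -/
abbrev XScheme (b : Basis (Fin 3) ℂ V) : Scheme := Spec (CommRingCat.of (XRing b))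

variable (V) in
/-- The variety `(V ⊗ V)_1`. -/
abbrev ConeScheme : Scheme := Spec (CommRingCat.of (ConeRing V))

/-- The double cover `f : X(V) → Y(V)`. -/
def coverMap (b : Basis (Fin 3) ℂ V) : XScheme b ⟶ YScheme b :=
  Spec.map (CommRingCat.ofHom
    (SymmPresentation.CoverRing.structureHom (universalPresentation b)))

/-- The covering involution of `X(V)`. -/
def coverInvolution (b : Basis (Fin 3) ℂ V) : XScheme b ⟶ XScheme b :=
  Spec.map (CommRingCat.ofHom (SymmPresentation.CoverRing.involution (universalPresentation b)))

/-- The pull-back of functions under `μ ↦ μ + μ^t` from `Y(V)` to `(V ⊗ V)_1`. -/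
def sigmaRingHom (b : Basis (Fin 3) ℂ V) : YRing b →+* ConeRing V :=
  Ideal.Quotient.lift _
    ((Ideal.Quotient.mk (idealOf (rankOneCone V))).comp (pullback symmetrize).toRingHom)
    fun p hp => Ideal.Quotient.eq_zero_iff_mem.2 <| mem_idealOf.2 fun μ hμ =>
      (evalAt_pullback symmetrize μ p).trans
        (fitt_le_ker_evalAt b (tensorRank_symmetrize_lt hμ) p hp)

/-- The map `σ : (V ⊗ V)_1 → Y(V)`, `μ ↦ μ + μ^t`. -/
def sigmaMap (b : Basis (Fin 3) ℂ V) : ConeScheme V ⟶ YScheme b :=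
  Spec.map (CommRingCat.ofHom (sigmaRingHom b))

variable (V) in
/-- The pull-back of functions on `(V ⊗ V)_1` under `μ ↦ μ^t`. -/
def coneTransposeRingHom : ConeRing V →+* ConeRing V :=
  Ideal.Quotient.lift _
    ((Ideal.Quotient.mk (idealOf (rankOneCone V))).comp (pullback transposeMap).toRingHom)
    fun p hp => Ideal.Quotient.eq_zero_iff_mem.2 <| mem_idealOf.2 fun μ hμ =>
      (evalAt_pullback transposeMap μ p).trans
        (mem_idealOf.1 hp _ ((tensorRank_transposeMap μ).trans_le hμ))

variable (V) in
/-- The transposition `μ ↦ μ^t` on `(V ⊗ V)_1`. -/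
def coneTranspose : ConeScheme V ⟶ ConeScheme V :=
  Spec.map (CommRingCat.ofHom (coneTransposeRingHom V))

/-- The fibre coordinates `ξ_k` on `X(V)`: the classes in `N` of the basis vectors of `V`. -/
def xiCoord (b : Basis (Fin 3) ℂ V) (k : Fin 3) : XRing b :=
  SymmPresentation.CoverRing.ofN _ ((universalPresentation b).proj (1 ⊗ₜ[ℂ] b k))

/-- The linear function `μ ↦ μ_{k+1,k+2} - μ_{k+2,k+1}` (indices modulo `3`) on `V ⊗ V`. It is the
`k`-th coordinate of `μ - μ^t ∈ ⋀²V ≅ V^∨ ⊗ ⋀³V ≅ V^∨`. -/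
def skewCoord (b : Basis (Fin 3) ℂ V) (k : Fin 3) : Dual ℂ (V ⊗[ℂ] V) :=
  (b.tensorProduct b).coord (k + 1, k + 2) ∘ₗ (LinearMap.id - transposeMap)

/-- The class of a linear function on `V ⊗ V` in the coordinate ring of `(V ⊗ V)_1`. -/
def coneLinear (l : Dual ℂ (V ⊗[ℂ] V)) : ConeRing V :=
  Ideal.Quotient.mk _ (SymmetricAlgebra.ι ℂ (Dual ℂ (V ⊗[ℂ] V)) l)

/-- The closed point of `(V ⊗ V)_1` given by a tensor of rank at most one. -/
def conePoint (μ : V ⊗[ℂ] V) (hμ : μ ∈ rankOneCone V) : ConeScheme V :=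
  PrimeSpectrum.comap (Ideal.Quotient.lift (idealOf (rankOneCone V)) (evalAt μ).toRingHom
    fun _ hp => mem_idealOf.1 hp μ hμ) (⊥ : PrimeSpectrum ℂ)

/-- The closed point of `Y(V)` given by a degenerate symmetric tensor. -/
def yPoint (b : Basis (Fin 3) ℂ V) (α : Sym2Tensor V) (hα : α ∈ degenerate V) : YScheme b :=
  PrimeSpectrum.comap (Ideal.Quotient.lift (universalPresentation b).fitt (evalAt α).toRingHom
    fun p hp => fitt_le_ker_evalAt b hα p hp) (⊥ : PrimeSpectrum ℂ)

/-- The singular locus of `X(V)`: the points at which `X(V)` is not smooth over `ℂ`. -/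
def singularLocus (b : Basis (Fin 3) ℂ V) : Set (XScheme b) :=
  {x | x ∉ Algebra.smoothLocus ℂ (XRing b)}

end Universal
end

/-!
At a tensor `μ = v ⊗ w` of rank at most one, the matrix of `σ μ` is `v wᵗ + w vᵗ`. This matrix kills
the cross product `v × w` and has cofactor matrix `-(v × w)(v × w)ᵗ`, so `ξ_k ↦ √-1 (v × w)_k`
extends `σ^*` to a homomorphism `τ^*` on the coordinate ring of `X(V)`.

The determinant of the generic symmetric matrix is irreducible, so by the Nullstellensatz `(det M)`
is the ideal of the degenerate symmetric tensors. Each of these is of the form `v ⊗ w + w ⊗ v`: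
diagonalize it and write `x² + y² = (x + √-1 y)(x - √-1 y)`. Hence `σ^*` is injective. The
involutions separate the even and the odd part, and the pairing on `N` is nondegenerate; so `τ^*`
is injective too. It is surjective because each `μ_{ij}` is the sum of a symmetric and a
skew-symmetric coordinate.

Where `μ_{ij} ≠ 0`, the relations `μ_{ij} μ_{kl} = μ_{il} μ_{kj}` turn the `i`-th row and the `j`-th
column into coordinates of the cone. At the origin they show that the cone is not smooth: every
tensor is a tangent vector there, but not all of them extend to second order.
-/

noncomputable section

open Matrix

section Tensors

variable {V : Type*} [AddCommGroup V] [Module ℂ V] {ι : Type*}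

/-- The coordinate function `μ ↦ μ_{ij}` on `V ⊗ V`, for `μ = ∑ μ_{ij} b_i ⊗ b_j`. -/
def tensorCoord (b : Basis ι ℂ V) (i j : ι) : Dual ℂ (V ⊗[ℂ] V) :=
  (b.tensorProduct b).coord (i, j)

lemma tensorCoord_tmul (b : Basis ι ℂ V) (i j : ι) (v w : V) :
    tensorCoord b i j (v ⊗ₜ[ℂ] w) = b.repr v i * b.repr w j := by
  simp [tensorCoord, mul_comm]

lemma tensorCoord_ext (b : Basis ι ℂ V) {μ ν : V ⊗[ℂ] V}
    (h : ∀ i j, tensorCoord b i j μ = tensorCoord b i j ν) : μ = ν :=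
  (b.tensorProduct b).ext_elem fun q => h q.1 q.2

lemma coord_toHom_coord (b : Basis ι ℂ V) (i j : ι) (μ : V ⊗[ℂ] V) :
    b.coord i (toHom μ (b.coord j)) = tensorCoord b i j μ := by
  induction μ with
  | zero => simp
  | tmul v w => simp [toHom_tmul, tensorCoord_tmul, mul_comm]
  | add x y hx hy => rw [map_add, map_add, LinearMap.add_apply, map_add, hx, hy]

lemma tensorCoord_transposeMap (b : Basis ι ℂ V) (i j : ι) (μ : V ⊗[ℂ] V) :
    tensorCoord b i j (transposeMap μ) = tensorCoord b j i μ := by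
  rw [← coord_toHom_coord, toHom_transposeMap, coord_toHom_coord]

lemma tensorCoord_comm (b : Basis ι ℂ V) (i j : ι) (α : Sym2Tensor V) :
    tensorCoord b i j (α : V ⊗[ℂ] V) = tensorCoord b j i (α : V ⊗[ℂ] V) := by
  conv_lhs => rw [← mem_sym2Tensor.1 α.2, tensorCoord_transposeMap]

lemma coe_symmetrize (μ : V ⊗[ℂ] V) : (symmetrize μ : V ⊗[ℂ] V) = μ + transposeMap μ := rfl

lemma tensorCoord_symmetrize (b : Basis ι ℂ V) (i j : ι) (μ : V ⊗[ℂ] V) :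
    tensorCoord b i j (symmetrize μ : V ⊗[ℂ] V) = tensorCoord b i j μ + tensorCoord b j i μ := by
  rw [coe_symmetrize, map_add, tensorCoord_transposeMap]

lemma toMatrix_toHom [Fintype ι] [DecidableEq ι] (b : Basis ι ℂ V) (μ : V ⊗[ℂ] V) :
    LinearMap.toMatrix b.dualBasis b (toHom μ) = of fun i j => tensorCoord b i j μ := by
  ext i j
  rw [LinearMap.toMatrix_apply, b.coe_dualBasis, of_apply, ← coord_toHom_coord, b.coord_apply]

lemma tensorRank_eq_rank [Fintype ι] (b : Basis ι ℂ V) (μ : V ⊗[ℂ] V) :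
    tensorRank μ = (of fun i j => tensorCoord b i j μ).rank := by
  classical
  rw [← toMatrix_toHom, rank_eq_finrank_range_toLin _ b b.dualBasis, toLin_toMatrix, tensorRank]

lemma tmul_mem_rankOneCone (v w : V) : v ⊗ₜ[ℂ] w ∈ rankOneCone V := by
  have h : LinearMap.range (toHom (v ⊗ₜ[ℂ] w)) ≤ ℂ ∙ v := by
    rintro _ ⟨φ, rfl⟩
    rw [toHom_tmul]
    exact Submodule.smul_mem _ _ (Submodule.mem_span_singleton_self v)
  exact (Submodule.finrank_mono h).trans ((finrank_span_le_card {v}).trans (by simp))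

-- `x² + y² = (x + iy)(x - iy)`
lemma tmul_self_add_tmul_self (x y : V) : x ⊗ₜ[ℂ] x + y ⊗ₜ[ℂ] y =
    symmetrize ((x + Complex.I • y) ⊗ₜ[ℂ] ((2⁻¹ : ℂ) • (x - Complex.I • y))) := by
  rw [coe_symmetrize, transposeMap, LinearEquiv.coe_coe, comm_tmul]
  simp only [tmul_add, add_tmul, tmul_sub, sub_tmul, tmul_smul, ← smul_tmul']
  match_scalars <;> grind [Complex.I_sq]

variable [FiniteDimensional ℂ V]

lemma mem_rankOneCone_iff {μ : V ⊗[ℂ] V} : μ ∈ rankOneCone V ↔ ∃ v w : V, μ = v ⊗ₜ[ℂ] w := by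
  refine ⟨fun hμ => ?_, fun ⟨v, w, h⟩ => h ▸ tmul_mem_rankOneCone v w⟩
  obtain ⟨⟨v, _⟩, hv⟩ := finrank_le_one_iff.1 (show finrank ℂ (toHom μ).range ≤ 1 from hμ)
  let b := finBasis ℂ V
  have hv' (j) : ∃ c : ℂ, c • v = toHom μ (b.coord j) :=
    (hv ⟨_, b.coord j, rfl⟩).imp fun _ => congrArg Subtype.val
  choose c hc using hv'
  refine ⟨v, b.equivFun.symm c, tensorCoord_ext b fun i j => ?_⟩
  rw [← coord_toHom_coord, ← hc, tensorCoord_tmul, ← b.equivFun_apply,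
    ← b.equivFun_apply, LinearEquiv.apply_symm_apply]
  simp [mul_comm]

-- Diagonalize the quadratic form on `V^∨` given by `α`.
lemma exists_tensorCoord_eq_diagonal (α : Sym2Tensor V) :
    ∃ (n : ℕ) (p : Basis (Fin n) ℂ V) (d : Fin n → ℂ),
      (of fun i j => tensorCoord p i j (α : V ⊗[ℂ] V)) = diagonal d := by
  let B : LinearMap.BilinForm ℂ (Dual ℂ V) := Dual.eval ℂ V ∘ₗ toHom (α : V ⊗[ℂ] V)
  have hB : LinearMap.IsSymm B := ⟨fun φ ψ => by
    have h := toHom_transposeMap (α : V ⊗[ℂ] V) φ ψ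
    rwa [mem_sym2Tensor.1 α.2] at h⟩
  have : Invertible (2 : ℂ) := invertibleOfNonzero two_ne_zero
  obtain ⟨q, hq⟩ := LinearMap.BilinForm.exists_orthogonal_basis hB
  let p := q.dualBasis.map (evalEquiv ℂ V).symm
  have hp (i) : p.coord i = q i := by
    refine p.ext fun j => ?_
    rw [p.coord_apply, p.repr_self, Basis.map_apply, q.coe_dualBasis, apply_evalEquiv_symm_apply,
      q.coord_apply, q.repr_self, Finsupp.single_apply, Finsupp.single_apply]
    simp only [eq_comm]
  refine ⟨_, p, fun i => B (q i) (q i), ?_⟩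
  ext i j
  rw [of_apply, ← coord_toHom_coord, hp, hp]
  obtain rfl | hij := eq_or_ne i j
  · rw [diagonal_apply_eq]; rfl
  · rw [diagonal_apply_ne _ hij]; exact hq hij.symm

lemma exists_eq_sum_tmul_self (α : Sym2Tensor V) :
    ∃ z : Fin (tensorRank (α : V ⊗[ℂ] V)) → V, (α : V ⊗[ℂ] V) = ∑ k, z k ⊗ₜ[ℂ] z k := by
  obtain ⟨n, p, d, hd⟩ := exists_tensorCoord_eq_diagonal α
  have hα : (α : V ⊗[ℂ] V) = ∑ k, d k • p k ⊗ₜ[ℂ] p k := by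
    refine tensorCoord_ext p fun i j => ?_
    have hij : tensorCoord p i j (α : V ⊗[ℂ] V) = diagonal d i j := congrFun₂ hd i j
    obtain rfl | hne := eq_or_ne i j
    · simp [hij, tensorCoord_tmul, Finsupp.single_apply]
    · simp [hij, tensorCoord_tmul, Finsupp.single_apply, hne, hne.symm]
  obtain ⟨e⟩ : Nonempty (Fin (tensorRank (α : V ⊗[ℂ] V)) ≃ {k // d k ≠ 0}) := by
    rw [tensorRank_eq_rank p, hd, rank_diagonal]
    exact ⟨(Fintype.equivFin _).symm⟩
  choose r hr using fun k => IsAlgClosed.exists_pow_nat_eq (d k) two_pos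
  refine ⟨fun k => r (e k) • p (e k), ?_⟩
  calc (α : V ⊗[ℂ] V) = ∑ k : {k // d k ≠ 0}, d k • p k ⊗ₜ[ℂ] p k := by
        rw [hα, ← Finset.sum_filter_of_ne (p := fun k => d k ≠ 0)
          fun k _ hk h0 => hk (by rw [h0, zero_smul]),
          Finset.sum_subtype (p := fun k => d k ≠ 0) _ (by simp)]
    _ = ∑ k, d (e k) • p (e k) ⊗ₜ[ℂ] p (e k) := (e.sum_comp _).symm
    _ = ∑ k, (r (e k) • p (e k)) ⊗ₜ[ℂ] (r (e k) • p (e k)) := by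
        simp only [smul_tmul_smul, ← hr, sq]

lemma exists_eq_symmetrize_tmul {α : Sym2Tensor V} (hα : α ∈ degenerate V) :
    ∃ v w : V, α = symmetrize (v ⊗ₜ[ℂ] w) := by
  have hr : tensorRank (α : V ⊗[ℂ] V) < 3 := hα
  obtain ⟨x, y, hxy⟩ : ∃ x y : V, (α : V ⊗[ℂ] V) = x ⊗ₜ[ℂ] x + y ⊗ₜ[ℂ] y := by
    obtain ⟨z, hz⟩ := exists_eq_sum_tmul_self α
    generalize tensorRank (α : V ⊗[ℂ] V) = r at hr z
    interval_cases r
    · exact ⟨0, 0, by simp [hz]⟩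
    · exact ⟨z 0, 0, by simp [hz]⟩
    · exact ⟨z 0, z 1, by simp [hz]⟩
  exact ⟨_, _, Subtype.ext (hxy.trans (tmul_self_add_tmul_self x y))⟩

end Tensors

section GenericSymmetric

open MvPolynomial

/-- The symmetric `n × n` matrix whose entries on and above the diagonal are independent
variables; the unordered pair `s(i, j)` indexes the variable at the positions `(i, j)` and
`(j, i)`. -/
def genericSymMatrix (n R : Type*) [CommRing R] : Matrix n n (MvPolynomial (Sym2 n) R) :=
  of fun i j => X s(i, j)

lemma notMem_vars_iff {σ R : Type*} [CommRing R] {p : MvPolynomial σ R} {i : σ} :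
    i ∉ p.vars ↔ p ∈ supported R {i}ᶜ := by
  rw [mem_supported, Set.subset_compl_singleton_iff, Finset.mem_coe]

variable {R : Type*} [CommRing R] [IsDomain R]

lemma irreducible_X_mul_X_sub_X_sq {σ : Type*} {i j k : σ} (hik : i ≠ k) (hij : i ≠ j)
    (hjk : j ≠ k) : Irreducible (X i * X j - X k ^ 2 : MvPolynomial σ R) := by
  have hX (l : σ) (hl : l ≠ j) : (X l : MvPolynomial σ R) ∈ supported R {j}ᶜ :=
    X_mem_supported.2 hl
  rw [sub_eq_add_neg]
  refine irreducible_mul_X_add _ _ j (X_ne_zero i) (notMem_vars_iff.2 (hX i hij))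
    (notMem_vars_iff.2 (neg_mem (pow_mem (hX k hjk.symm) 2))) ?_
  refine (X_prime (i := i)).irreducible.isRelPrime_iff_not_dvd.2 fun h => hik ?_
  exact X_dvd_X.1 ((X_prime (i := i)).dvd_of_dvd_pow ((dvd_neg).1 h))

lemma irreducible_det_genericSymMatrix : Irreducible (genericSymMatrix (Fin 3) R).det := by
  let D : MvPolynomial (Sym2 (Fin 3)) R := X s(1, 1) * X s(2, 2) - X s(1, 2) ^ 2
  let E : MvPolynomial (Sym2 (Fin 3)) R := 2 * X s(0, 1) * X s(0, 2) * X s(1, 2)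
    - X s(0, 1) ^ 2 * X s(2, 2) - X s(0, 2) ^ 2 * X s(1, 1)
  have hdet : (genericSymMatrix (Fin 3) R).det = D * X s(0, 0) + E := by
    have h10 : s((1 : Fin 3), 0) = s(0, 1) := Sym2.eq_swap
    have h20 : s((2 : Fin 3), 0) = s(0, 2) := Sym2.eq_swap
    have h21 : s((2 : Fin 3), 1) = s(1, 2) := Sym2.eq_swap
    simp only [det_fin_three, genericSymMatrix, of_apply, h10, h20, h21, D, E]
    ring
  have hX (s : Sym2 (Fin 3)) (hs : s ≠ s(0, 0)) :
      (X s : MvPolynomial (Sym2 (Fin 3)) R) ∈ supported R {s(0, 0)}ᶜ := X_mem_supported.2 hs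
  have hD : Irreducible D := irreducible_X_mul_X_sub_X_sq (by decide) (by decide) (by decide)
  have hE : ¬ D ∣ E := fun h => by
    let x : Sym2 (Fin 3) → R := fun s => if s = s(1, 1) ∨ s = s(0, 2) then 1 else 0
    have := (eval x).map_dvd h
    simp [D, E, x] at this
  rw [hdet]
  refine irreducible_mul_X_add _ _ _ hD.ne_zero (notMem_vars_iff.2 ?_) (notMem_vars_iff.2 ?_)
    (hD.isRelPrime_iff_not_dvd.2 hE)
  · exact sub_mem (mul_mem (hX _ (by decide)) (hX _ (by decide))) (pow_mem (hX _ (by decide)) 2)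
  · exact sub_mem (sub_mem (mul_mem (mul_mem (mul_mem (ofNat_mem _ 2) (hX _ (by decide)))
      (hX _ (by decide))) (hX _ (by decide)))
      (mul_mem (pow_mem (hX _ (by decide)) 2) (hX _ (by decide))))
      (mul_mem (pow_mem (hX _ (by decide)) 2) (hX _ (by decide)))

end GenericSymmetric

section Regular

variable {W : Type*} [AddCommGroup W] [Module ℂ W] {ι : Type*}

lemma evalAt_ι (w : W) (l : Dual ℂ W) : evalAt w (SymmetricAlgebra.ι ℂ (Dual ℂ W) l) = l w := by
  simp [evalAt]

variable (e : Basis ι ℂ W)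

lemma evalAt_equivMvPolynomial_symm [Finite ι] [DecidableEq ι] (w : W) (p : MvPolynomial ι ℂ) :
    evalAt w ((SymmetricAlgebra.equivMvPolynomial e.dualBasis).symm p) =
      MvPolynomial.aeval (e.equivFun w) p := by
  have h : (evalAt w).comp (SymmetricAlgebra.equivMvPolynomial e.dualBasis).symm.toAlgHom =
      MvPolynomial.aeval (e.equivFun w) :=
    MvPolynomial.algHom_ext fun i => by
      simp [SymmetricAlgebra.equivMvPolynomial_symm_X, evalAt_ι]
  exact DFunLike.congr_fun h p

lemma adjoin_range_ι_coord [Finite ι] :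
    Algebra.adjoin ℂ (Set.range fun i => SymmetricAlgebra.ι ℂ (Dual ℂ W) (e.coord i)) = ⊤ := by
  have := Fintype.ofFinite ι
  classical
  let φ := (SymmetricAlgebra.equivMvPolynomial e.dualBasis).symm
  have hφ : (fun i => SymmetricAlgebra.ι ℂ (Dual ℂ W) (e.coord i)) = φ.toAlgHom ∘ .X := by
    funext i
    rw [← e.coe_dualBasis]
    exact (SymmetricAlgebra.equivMvPolynomial_symm_X e.dualBasis i).symm
  rw [hφ, Set.range_comp, ← AlgHom.map_adjoin, MvPolynomial.adjoin_range_X, Algebra.map_top]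
  exact (AlgHom.range_eq_top _).2 φ.surjective

lemma idealOf_setOf_evalAt_eq_zero [FiniteDimensional ℂ W] (I : Ideal (Reg W)) :
    idealOf {w | ∀ p ∈ I, evalAt w p = 0} = I.radical := by
  let e := finBasis ℂ W
  let φ := SymmetricAlgebra.equivMvPolynomial e.dualBasis
  have heval (w : W) (p) : evalAt w (φ.symm p) = MvPolynomial.aeval (e.equivFun w) p :=
    evalAt_equivMvPolynomial_symm e w p
  have hzero (w : W) : (∀ p ∈ I, evalAt w p = 0) ↔
      e.equivFun w ∈ MvPolynomial.zeroLocus ℂ (I.comap φ.symm) := by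
    refine φ.symm.surjective.forall.trans (forall_congr' fun p => ?_)
    rw [heval, Ideal.mem_comap]
  ext q
  obtain ⟨q, rfl⟩ := φ.symm.surjective q
  calc φ.symm q ∈ idealOf {w | ∀ p ∈ I, evalAt w p = 0}
    _ ↔ q ∈ MvPolynomial.vanishingIdeal ℂ (MvPolynomial.zeroLocus ℂ (I.comap φ.symm)) := by
      rw [mem_idealOf, MvPolynomial.mem_vanishingIdeal_iff, e.equivFun.surjective.forall]
      simp only [Set.mem_ofPred_eq, hzero, heval]
    _ ↔ φ.symm q ∈ I.radical := by
      rw [MvPolynomial.vanishingIdeal_zeroLocus_eq_radical, ← Ideal.comap_radical,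
        Ideal.mem_comap]

end Regular

section SymmetricTensors

variable {V : Type*} [AddCommGroup V] [Module ℂ V] {ι : Type*} [Finite ι]

/-- The coordinates `α ↦ α_{ij} = α_{ji}` on `Sym²V`, indexed by unordered pairs `s(i, j)`. -/
def sym2TensorCoords (b : Basis ι ℂ V) : Sym2Tensor V →ₗ[ℂ] Sym2 ι → ℂ :=
  LinearMap.pi <| Sym2.lift ⟨fun i j => tensorCoord b i j ∘ₗ (Sym2Tensor V).subtype, fun i j =>
    LinearMap.ext fun α => tensorCoord_comm b i j α⟩

lemma sym2TensorCoords_bijective (b : Basis ι ℂ V) :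
    Function.Bijective (sym2TensorCoords b) := by
  refine ⟨fun α β h => Subtype.ext (tensorCoord_ext b fun i j => congrFun h s(i, j)), fun c => ?_⟩
  let μ := (b.tensorProduct b).equivFun.symm fun q => c s(q.1, q.2)
  have hμ (i j : ι) : tensorCoord b i j μ = c s(i, j) :=
    congrFun ((b.tensorProduct b).equivFun.apply_symm_apply _) (i, j)
  refine ⟨⟨μ, tensorCoord_ext b fun i j => ?_⟩, funext <| Sym2.ind hμ⟩
  rw [tensorCoord_transposeMap, LinearMap.id_apply, hμ, hμ, Sym2.eq_swap]

/-- The basis of `Sym²V` dual to the coordinates `α ↦ α_{ij}`, indexed by unordered pairs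
`s(i, j)`. -/
def sym2TensorBasis (b : Basis ι ℂ V) : Basis (Sym2 ι) ℂ (Sym2Tensor V) :=
  .ofEquivFun (.ofBijective (sym2TensorCoords b) (sym2TensorCoords_bijective b))

lemma sym2TensorBasis_coord (b : Basis ι ℂ V) (i j : ι) :
    (sym2TensorBasis b).coord s(i, j) = tensorCoord b i j ∘ₗ (Sym2Tensor V).subtype := rfl

end SymmetricTensors

section Determinant

variable {V : Type*} [AddCommGroup V] [Module ℂ V] [FiniteDimensional ℂ V]
  (b : Basis (Fin 3) ℂ V)

lemma universalPresentation_mat_apply (i j : Fin 3) :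
    (universalPresentation b).mat i j = SymmetricAlgebra.ι ℂ (Dual ℂ (Sym2Tensor V))
      (tensorCoord b i j ∘ₗ (Sym2Tensor V).subtype) := by
  refine (tautological_matrix b i j).trans (congrArg _ (LinearMap.ext fun α => ?_))
  exact coord_toHom_coord b i j α

lemma prime_det_mat : Prime (universalPresentation b).mat.det := by
  let φ := (SymmetricAlgebra.equivMvPolynomial (sym2TensorBasis b).dualBasis).symm
  have hφ : (genericSymMatrix (Fin 3) ℂ).map φ = (universalPresentation b).mat := by
    ext i j
    rw [map_apply, genericSymMatrix, of_apply, universalPresentation_mat_apply,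
      SymmetricAlgebra.equivMvPolynomial_symm_X, Basis.coe_dualBasis, sym2TensorBasis_coord]
  have hdet : φ (genericSymMatrix (Fin 3) ℂ).det = (universalPresentation b).mat.det := by
    rw [← hφ]
    exact AlgEquiv.map_det φ _
  rw [← hdet, MulEquiv.prime_iff φ]
  exact irreducible_det_genericSymMatrix.prime

lemma degenerate_eq_setOf_evalAt_det :
    degenerate V = {α | ∀ p ∈ (universalPresentation b).fitt, evalAt α p = 0} := by
  refine Set.Subset.antisymm (fun α hα => fitt_le_ker_evalAt b hα) fun α hα => ?_
  have hdet := hα _ (Ideal.mem_span_singleton_self _)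
  rw [evalAt_det, toMatrix_toHom] at hdet
  by_contra hrank
  rw [degenerate, Set.mem_ofPred_eq, tensorRank_eq_rank b, not_lt] at hrank
  have hsurj := LinearMap.range_eq_top.1 (Submodule.eq_top_of_finrank_eq
    ((rank_le_height _).antisymm hrank |>.trans (finrank_fin_fun ℂ).symm))
  exact ((isUnit_iff_isUnit_det _).1 (mulVec_surjective_iff_isUnit.1 hsurj)).ne_zero hdet

lemma idealOf_degenerate : idealOf (degenerate V) = (universalPresentation b).fitt := by
  rw [degenerate_eq_setOf_evalAt_det b, idealOf_setOf_evalAt_eq_zero]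
  exact ((Ideal.span_singleton_prime (prime_det_mat b).ne_zero).2 (prime_det_mat b)).radical

end Determinant

section ConeFunctions

variable {V : Type*} [AddCommGroup V] [Module ℂ V] {ι : Type*}

/-- Evaluation of functions on `(V ⊗ V)_1` at a point. -/
def coneEval (μ : V ⊗[ℂ] V) (hμ : μ ∈ rankOneCone V) : ConeRing V →ₐ[ℂ] ℂ :=
  Ideal.Quotient.liftₐ (idealOf (rankOneCone V)) (evalAt μ) fun _ hp => mem_idealOf.1 hp μ hμ

lemma coneEval_coneLinear (μ : V ⊗[ℂ] V) (hμ : μ ∈ rankOneCone V) (l : Dual ℂ (V ⊗[ℂ] V)) :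
    coneEval μ hμ (coneLinear l) = l μ :=
  evalAt_ι μ l

/-- The generic matrix `(μ_{ij})` on `(V ⊗ V)_1`. -/
def coneMatrix (b : Basis ι ℂ V) : Matrix ι ι (ConeRing V) :=
  of fun i j => coneLinear (tensorCoord b i j)

lemma coneMatrix_apply (b : Basis ι ℂ V) (i j : ι) :
    coneMatrix b i j = coneLinear (tensorCoord b i j) := rfl

lemma coneMatrix_map_coneEval_tmul (b : Basis ι ℂ V) (v w : V) :
    (coneMatrix b).map (coneEval _ (tmul_mem_rankOneCone v w)) =
      vecMulVec (b.repr v) (b.repr w) := by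
  ext i j
  rw [map_apply, coneMatrix_apply, coneEval_coneLinear, tensorCoord_tmul, vecMulVec_apply]

lemma coneLinear_add (l l' : Dual ℂ (V ⊗[ℂ] V)) :
    coneLinear (l + l') = coneLinear l + coneLinear l' := by
  simp only [coneLinear, map_add]

lemma coneLinear_smul (c : ℂ) (l : Dual ℂ (V ⊗[ℂ] V)) :
    coneLinear (c • l) = c • coneLinear l := by
  simp only [coneLinear, map_smul]
  rfl

lemma adjoin_range_coneMatrix [Finite ι] (b : Basis ι ℂ V) :
    Algebra.adjoin ℂ (Set.range fun q : ι × ι => coneMatrix b q.1 q.2) = ⊤ := by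
  let π := Ideal.Quotient.mkₐ ℂ (idealOf (rankOneCone V))
  have hπ : (fun q : ι × ι => coneMatrix b q.1 q.2) =
      π ∘ fun q => SymmetricAlgebra.ι ℂ _ ((b.tensorProduct b).coord q) := rfl
  rw [hπ, Set.range_comp, ← AlgHom.map_adjoin, adjoin_range_ι_coord, Algebra.map_top]
  exact (AlgHom.range_eq_top _).2 (Ideal.Quotient.mkₐ_surjective _ _)

lemma coneEval_coneTransposeRingHom [FiniteDimensional ℂ V] (v w : V) (x : ConeRing V) :
    coneEval _ (tmul_mem_rankOneCone v w) (coneTransposeRingHom V x) =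
      coneEval _ (tmul_mem_rankOneCone w v) x := by
  obtain ⟨p, rfl⟩ := Ideal.Quotient.mk_surjective x
  exact evalAt_pullback transposeMap (v ⊗ₜ w) p

variable [FiniteDimensional ℂ V]

lemma coneRing_ext {x y : ConeRing V} (h : ∀ v w, coneEval _ (tmul_mem_rankOneCone v w) x =
    coneEval _ (tmul_mem_rankOneCone v w) y) : x = y := by
  obtain ⟨p, rfl⟩ := Ideal.Quotient.mk_surjective x
  obtain ⟨q, rfl⟩ := Ideal.Quotient.mk_surjective y
  refine Ideal.Quotient.eq.2 (mem_idealOf.2 fun μ hμ => ?_)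
  obtain ⟨v, w, rfl⟩ := mem_rankOneCone_iff.1 hμ
  rw [map_sub, sub_eq_zero]
  exact h v w

lemma coneMatrix_mul_coneMatrix (b : Basis ι ℂ V) (i j k l : ι) :
    coneMatrix b i j * coneMatrix b k l = coneMatrix b i l * coneMatrix b k j := by
  refine coneRing_ext fun v w => ?_
  simp only [map_mul, coneMatrix_apply, coneEval_coneLinear, tensorCoord_tmul]
  ring

end ConeFunctions

section CrossProduct

variable {R : Type*} [CommRing R] (v w : Fin 3 → R)

lemma vecMulVec_add_vecMulVec_mulVec_cross : (vecMulVec v w + vecMulVec w v) *ᵥ (v ⨯₃ w) = 0 := by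
  rw [add_mulVec, vecMulVec_mulVec, vecMulVec_mulVec, dot_self_cross, dot_cross_self]
  simp

lemma adjugate_vecMulVec_add_vecMulVec :
    (vecMulVec v w + vecMulVec w v).adjugate = -vecMulVec (v ⨯₃ w) (v ⨯₃ w) := by
  rw [adjugate_fin_three, cross_apply]
  ext i j
  fin_cases i <;> fin_cases j <;> simp [vecMulVec_apply] <;> ring

end CrossProduct

namespace SymmPresentation

variable {R U₁ U₀ : Type*} [CommRing R] [AddCommGroup U₁] [Module R U₁]
  [AddCommGroup U₀] [Module R U₀] (S : SymmPresentation R U₁ U₀)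

lemma eq_zero_of_pairing_eq_zero (hdet : S.mat.det ∈ nonZeroDivisors R) {n : S.N}
    (h : ∀ n', S.pairing n' n = 0) : n = 0 := by
  obtain ⟨u, rfl⟩ := S.proj_surjective n
  have hdvd (i : Fin 3) : S.mat.det ∣ (S.mat.adjugate *ᵥ S.tgtBasis.repr u) i := by
    have hi := h (S.proj (S.tgtBasis i))
    rwa [pairing_proj, Ideal.Quotient.eq_zero_iff_mem, fitt, Ideal.mem_span_singleton,
      cofactorForm_apply, Basis.repr_self, Finsupp.single_eq_pi_single,
      single_one_dotProduct] at hi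
  choose z hz using hdvd
  have hmul : S.mat.det • ⇑(S.tgtBasis.repr u) = S.mat.det • S.mat *ᵥ z :=
    calc S.mat.det • ⇑(S.tgtBasis.repr u)
      _ = S.mat *ᵥ S.mat.adjugate *ᵥ S.tgtBasis.repr u := by
        rw [mulVec_mulVec, mul_adjugate, smul_mulVec, one_mulVec]
      _ = S.mat *ᵥ (S.mat.det • z) := congrArg _ (funext hz)
      _ = S.mat.det • S.mat *ᵥ z := mulVec_smul ..
  exact S.proj_eq_zero u z <| funext fun i =>
    (mul_cancel_left_mem_nonZeroDivisors hdet).1 (congrFun hmul i)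

/-- The data that define a ring homomorphism `R/(det M) ⊕ N → C`: a ring homomorphism on
`R/(det M)`, and images of the generators of `N` that satisfy the relations of `N` and of the
multiplication `N × N → R/(det M)`. -/
structure LiftData (C : Type*) [CommRing C] where
  base : R ⧸ S.fitt →+* C
  gen : Fin 3 → C
  mat_mulVec_gen : S.mat.map (base.comp (Ideal.Quotient.mk _)) *ᵥ gen = 0
  vecMulVec_gen : vecMulVec gen gen = S.mat.adjugate.map (base.comp (Ideal.Quotient.mk _))

namespace LiftData

variable {S} {C : Type*} [CommRing C] (φ : S.LiftData C)

/-- The composite `R → R/(det M) → C`. -/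
def coeff : R →+* C := φ.base.comp (Ideal.Quotient.mk _)

/-- The semilinear map `U₀ → C` with the prescribed values on the basis. -/
def freeLift : U₀ →ₛₗ[φ.coeff] C where
  toFun u := (φ.coeff ∘ S.tgtBasis.repr u) ⬝ᵥ φ.gen
  map_add' u v := by simp [dotProduct, add_mul, Finset.sum_add_distrib]
  map_smul' r u := by simp [dotProduct, Finset.mul_sum, mul_assoc]

lemma freeLift_apply (u : U₀) :
    φ.freeLift u = (φ.coeff ∘ S.tgtBasis.repr u) ⬝ᵥ φ.gen := rfl

lemma freeLift_map (y : U₁) : φ.freeLift (S.map y) = 0 := by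
  have hsymm : (S.mat.map φ.coeff)ᵀ = S.mat.map φ.coeff := by
    rw [← transpose_map, S.mat_isSymm]
  have hmul : φ.coeff ∘ (S.mat *ᵥ S.srcBasis.repr y) =
      S.mat.map φ.coeff *ᵥ (φ.coeff ∘ S.srcBasis.repr y) :=
    funext fun i => φ.coeff.map_mulVec S.mat _ i
  rw [freeLift_apply, repr_map, hmul, ← hsymm, mulVec_transpose, ← dotProduct_mulVec]
  exact (congrArg _ φ.mat_mulVec_gen).trans (dotProduct_zero _)

lemma freeLift_mul_freeLift (u v : U₀) :
    φ.freeLift u * φ.freeLift v = φ.coeff (S.cofactorForm u v) := by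
  have hmul : φ.coeff ∘ (S.mat.adjugate *ᵥ S.tgtBasis.repr v) =
      S.mat.adjugate.map φ.coeff *ᵥ (φ.coeff ∘ S.tgtBasis.repr v) :=
    funext fun i => φ.coeff.map_mulVec S.mat.adjugate _ i
  have hgen : S.mat.adjugate.map φ.coeff = vecMulVec φ.gen φ.gen := φ.vecMulVec_gen.symm
  rw [cofactorForm_apply, RingHom.map_dotProduct, hmul, hgen, vecMulVec_mulVec, dotProduct_smul,
    dotProduct_comm φ.gen]
  simp [freeLift_apply]

/-- The map `N → C` induced by `freeLift`. -/
def oddPart : S.N →ₛₗ[φ.coeff] C :=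
  (LinearMap.range S.map).liftQ φ.freeLift <| by
    rintro _ ⟨y, rfl⟩
    exact φ.freeLift_map y

lemma oddPart_proj (u : U₀) : φ.oddPart (S.proj u) = φ.freeLift u := rfl

lemma oddPart_smul (r : R ⧸ S.fitt) (n : S.N) : φ.oddPart (r • n) = φ.base r * φ.oddPart n := by
  obtain ⟨r, rfl⟩ := Ideal.Quotient.mk_surjective r
  exact φ.oddPart.map_smulₛₗ r n

lemma oddPart_mul_oddPart (n n' : S.N) :
    φ.oddPart n * φ.oddPart n' = φ.base (S.pairing n n') := by
  obtain ⟨u, rfl⟩ := S.proj_surjective n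
  obtain ⟨v, rfl⟩ := S.proj_surjective n'
  rw [pairing_proj, oddPart_proj, oddPart_proj, freeLift_mul_freeLift]
  rfl

/-- The ring homomorphism `R/(det M) ⊕ N → C` defined by `φ`. -/
def lift : S.CoverRing →+* C where
  toFun y := φ.base y.fst + φ.oddPart y.snd
  map_one' := by rw [CoverRing.fst_one, CoverRing.snd_one, map_one, map_zero, add_zero]
  map_zero' := by rw [CoverRing.fst_zero, CoverRing.snd_zero, map_zero, map_zero, add_zero]
  map_add' y z := by
    rw [CoverRing.fst_add, CoverRing.snd_add, map_add, map_add, add_add_add_comm]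
  map_mul' y z := by
    rw [CoverRing.fst_mul, CoverRing.snd_mul, map_add, map_add, map_mul, oddPart_smul,
      oddPart_smul, ← oddPart_mul_oddPart]
    ring

lemma lift_structureHom (r : R ⧸ S.fitt) :
    φ.lift (CoverRing.structureHom S r) = φ.base r :=
  (congrArg (φ.base r + ·) φ.oddPart.map_zero).trans (add_zero _)

lemma lift_ofN_proj (k : Fin 3) :
    φ.lift (CoverRing.ofN S (S.proj (S.tgtBasis k))) = φ.gen k := by
  have hfree : φ.freeLift (S.tgtBasis k) = φ.gen k := by
    rw [freeLift_apply, Basis.repr_self]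
    simp [dotProduct, Finsupp.single_apply]
  exact (congrArg₂ (· + ·) φ.base.map_zero hfree).trans (zero_add _)

lemma apply_lift (θ : C →+* C) (hbase : ∀ r, θ (φ.base r) = φ.base r)
    (hgen : ∀ k, θ (φ.gen k) = -φ.gen k) (y : S.CoverRing) :
    θ (φ.lift y) = φ.lift (CoverRing.involution S y) := by
  have hodd (n : S.N) : θ (φ.oddPart n) = φ.oddPart (-n) := by
    obtain ⟨u, rfl⟩ := S.proj_surjective n
    have hcoeff : θ ∘ φ.coeff ∘ S.tgtBasis.repr u = φ.coeff ∘ S.tgtBasis.repr u :=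
      funext fun i => hbase _
    rw [map_neg, oddPart_proj, freeLift_apply, RingHom.map_dotProduct, hcoeff, ← dotProduct_neg]
    exact congrArg _ (funext hgen)
  exact (map_add θ _ _).trans (congrArg₂ (· + ·) (hbase _) (hodd _))

-- The involution separates the two summands.
lemma lift_injective (hdet : S.mat.det ∈ nonZeroDivisors R) (htwo : (2 : C) ∈ nonZeroDivisors C)
    (hφ : Function.Injective φ.base) (θ : C →+* C) (hbase : ∀ r, θ (φ.base r) = φ.base r)
    (hgen : ∀ k, θ (φ.gen k) = -φ.gen k) : Function.Injective φ.lift := by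
  refine (injective_iff_map_eq_zero _).2 fun y hy => ?_
  have hsum : φ.base y.fst + φ.oddPart y.snd = 0 := hy
  have hdiff : φ.base y.fst + φ.oddPart (-y.snd) = 0 :=
    (φ.apply_lift θ hbase hgen y).symm.trans (by rw [hy, map_zero])
  rw [map_neg] at hdiff
  have hodd : φ.oddPart y.snd = 0 :=
    (mul_left_mem_nonZeroDivisors_eq_zero_iff htwo).1 (by linear_combination hsum - hdiff)
  have hfst : y.fst = 0 := hφ (by rw [map_zero, ← hsum, hodd, add_zero])
  have hsnd : y.snd = 0 := S.eq_zero_of_pairing_eq_zero hdet fun n' =>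
    hφ (by rw [map_zero, ← oddPart_mul_oddPart, hodd, mul_zero])
  exact CoverRing.ext hfst hsnd

end LiftData

end SymmPresentation

section Isomorphism

variable {V : Type*} [AddCommGroup V] [Module ℂ V] (b : Basis (Fin 3) ℂ V)

/-- The image `√-1 (μ_{k+1,k+2} - μ_{k+2,k+1})` of `ξ_k` under `τ^*`. -/
def xiImage (k : Fin 3) : ConeRing V := Complex.I • coneLinear (skewCoord b k)

lemma skewCoord_eq (k : Fin 3) : skewCoord b k =
    tensorCoord b (k + 1) (k + 2) - tensorCoord b (k + 2) (k + 1) :=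
  LinearMap.ext fun μ => (map_sub (tensorCoord b (k + 1) (k + 2)) μ _).trans
    (congrArg _ (tensorCoord_transposeMap b _ _ μ))

lemma coneEval_xiImage (v w : V) : coneEval _ (tmul_mem_rankOneCone v w) ∘ xiImage b =
    Complex.I • (b.repr v ⨯₃ b.repr w) := by
  funext k
  rw [Function.comp_apply, xiImage, map_smul, coneEval_coneLinear, skewCoord_eq, cross_apply,
    LinearMap.sub_apply, tensorCoord_tmul, tensorCoord_tmul]
  fin_cases k <;> simp

lemma coneMatrix_add_transpose_map_coneEval (v w : V) :
    (coneMatrix b + (coneMatrix b)ᵀ).map (coneEval _ (tmul_mem_rankOneCone v w)) =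
      vecMulVec (b.repr v) (b.repr w) + vecMulVec (b.repr w) (b.repr v) := by
  rw [Matrix.map_add _ (map_add _), transpose_map, coneMatrix_map_coneEval_tmul,
    transpose_vecMulVec]

lemma tensorCoord_sub_mem_span_skewCoord (i j : Fin 3) :
    tensorCoord b i j - tensorCoord b j i ∈ Submodule.span ℂ (Set.range (skewCoord b)) := by
  have hskew (k : Fin 3) : tensorCoord b (k + 1) (k + 2) - tensorCoord b (k + 2) (k + 1) ∈
      Submodule.span ℂ (Set.range (skewCoord b)) :=
    Submodule.subset_span ⟨k, skewCoord_eq b k⟩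
  obtain rfl | ⟨k, rfl, rfl⟩ | ⟨k, rfl, rfl⟩ :
      i = j ∨ (∃ k, i = k + 1 ∧ j = k + 2) ∨ ∃ k, i = k + 2 ∧ j = k + 1 := by
    revert i j
    decide
  · rw [sub_self]
    exact zero_mem _
  · exact hskew k
  · rw [← neg_sub]
    exact neg_mem (hskew k)

variable [FiniteDimensional ℂ V]

lemma coneMatrix_add_transpose_mulVec_xiImage :
    (coneMatrix b + (coneMatrix b)ᵀ) *ᵥ xiImage b = 0 := by
  refine funext fun i => coneRing_ext fun v w => ?_
  let ε : ConeRing V →+* ℂ := (coneEval _ (tmul_mem_rankOneCone v w)).toRingHom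
  refine (ε.map_mulVec _ _ i).trans ?_
  change ((coneMatrix b + (coneMatrix b)ᵀ).map (coneEval _ _) *ᵥ (coneEval _ _ ∘ _)) i = _
  rw [coneMatrix_add_transpose_map_coneEval, coneEval_xiImage, mulVec_smul,
    vecMulVec_add_vecMulVec_mulVec_cross, smul_zero, Pi.zero_apply, Pi.zero_apply, map_zero]

lemma vecMulVec_xiImage : vecMulVec (xiImage b) (xiImage b) =
    (coneMatrix b + (coneMatrix b)ᵀ).adjugate := by
  refine Matrix.ext fun i j => coneRing_ext fun v w => ?_
  let ε : ConeRing V →+* ℂ := (coneEval _ (tmul_mem_rankOneCone v w)).toRingHom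
  have hadj : ε ((coneMatrix b + (coneMatrix b)ᵀ).adjugate i j) =
      ((coneMatrix b + (coneMatrix b)ᵀ).map (coneEval _ _)).adjugate i j :=
    congrFun₂ (ε.map_adjugate _) i j
  have hxi (k : Fin 3) : coneEval _ _ (xiImage b k) = _ := congrFun (coneEval_xiImage b v w) k
  refine Eq.trans ?_ hadj.symm
  rw [coneMatrix_add_transpose_map_coneEval, adjugate_vecMulVec_add_vecMulVec, vecMulVec_apply,
    map_mul, hxi, hxi, Matrix.neg_apply, vecMulVec_apply, Pi.smul_apply, Pi.smul_apply,
    smul_eq_mul, smul_eq_mul]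
  linear_combination (b.repr v ⨯₃ b.repr w) i * (b.repr v ⨯₃ b.repr w) j * Complex.I_mul_I

lemma coneTransposeRingHom_xiImage (k : Fin 3) :
    coneTransposeRingHom V (xiImage b k) = -xiImage b k := by
  refine coneRing_ext fun v w => ?_
  have hxi (v w : V) : coneEval _ _ (xiImage b k) = _ := congrFun (coneEval_xiImage b v w) k
  rw [coneEval_coneTransposeRingHom, map_neg, hxi, hxi, ← cross_anticomm, smul_neg, Pi.neg_apply]

lemma coneEval_sigmaRingHom (μ : V ⊗[ℂ] V) (hμ : μ ∈ rankOneCone V) (p : RegSym V) :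
    coneEval μ hμ (sigmaRingHom b (Ideal.Quotient.mk _ p)) = evalAt (symmetrize μ) p :=
  evalAt_pullback symmetrize μ p

lemma sigmaRingHom_algebraMap (c : ℂ) : sigmaRingHom b (algebraMap ℂ _ c) = algebraMap ℂ _ c := by
  refine coneRing_ext fun v w => ?_
  refine (coneEval_sigmaRingHom b _ _ (algebraMap ℂ _ c)).trans ?_
  rw [AlgHom.commutes, AlgHom.commutes]

lemma universalPresentation_mat_map_sigmaRingHom :
    (universalPresentation b).mat.map ((sigmaRingHom b).comp (Ideal.Quotient.mk _)) =
      coneMatrix b + (coneMatrix b)ᵀ := by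
  refine Matrix.ext fun i j => coneRing_ext fun v w => ?_
  rw [map_apply, RingHom.comp_apply, coneEval_sigmaRingHom, universalPresentation_mat_apply,
    evalAt_ι, Matrix.add_apply, transpose_apply, map_add, coneMatrix_apply, coneMatrix_apply,
    coneEval_coneLinear, coneEval_coneLinear]
  exact tensorCoord_symmetrize b i j _

-- A function on `Y(V)` is determined by its values at the points `σ(v ⊗ w)`.
lemma sigmaRingHom_injective : Function.Injective (sigmaRingHom b) := by
  refine (injective_iff_map_eq_zero _).2 fun r hr => ?_
  obtain ⟨p, rfl⟩ := Ideal.Quotient.mk_surjective r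
  rw [Ideal.Quotient.eq_zero_iff_mem, ← idealOf_degenerate, mem_idealOf]
  intro α hα
  obtain ⟨v, w, rfl⟩ := exists_eq_symmetrize_tmul hα
  rw [← coneEval_sigmaRingHom b _ (tmul_mem_rankOneCone _ _), hr, map_zero]

lemma coneTransposeRingHom_sigmaRingHom (r : YRing b) :
    coneTransposeRingHom V (sigmaRingHom b r) = sigmaRingHom b r := by
  obtain ⟨p, rfl⟩ := Ideal.Quotient.mk_surjective r
  refine coneRing_ext fun v w => ?_
  have hsymm : symmetrize (w ⊗ₜ[ℂ] v) = symmetrize (v ⊗ₜ[ℂ] w) :=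
    Subtype.ext (add_comm (w ⊗ₜ v) _)
  rw [coneEval_coneTransposeRingHom, coneEval_sigmaRingHom, coneEval_sigmaRingHom, hsymm]

/-- The data that define `τ^*`: it is `σ^*` on functions on `Y(V)`, and `ξ_k ↦ xiImage b k`. -/
def tauLiftData : (universalPresentation b).LiftData (ConeRing V) where
  base := sigmaRingHom b
  gen := xiImage b
  mat_mulVec_gen := by
    rw [universalPresentation_mat_map_sigmaRingHom, coneMatrix_add_transpose_mulVec_xiImage]
  vecMulVec_gen := by
    rw [vecMulVec_xiImage, ← universalPresentation_mat_map_sigmaRingHom]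
    exact (RingHom.map_adjugate _ _).symm

/-- The ring homomorphism `τ^*`. -/
def tauHom : XRing b →ₐ[ℂ] ConeRing V where
  __ := (tauLiftData b).lift
  commutes' c := ((tauLiftData b).lift_structureHom _).trans (sigmaRingHom_algebraMap b c)

lemma tauHom_structureHom (r : YRing b) :
    tauHom b (SymmPresentation.CoverRing.structureHom _ r) = sigmaRingHom b r :=
  (tauLiftData b).lift_structureHom r

lemma tauHom_xiCoord (k : Fin 3) : tauHom b (xiCoord b k) = xiImage b k := by
  have hgen : (1 : RegSym V) ⊗ₜ[ℂ] b k = (universalPresentation b).tgtBasis k :=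
    (Basis.baseChange_apply (RegSym V) b k).symm
  rw [xiCoord, hgen]
  exact (tauLiftData b).lift_ofN_proj k

lemma tauHom_involution (x : XRing b) :
    tauHom b (SymmPresentation.CoverRing.involution _ x) =
      coneTransposeRingHom V (tauHom b x) :=
  ((tauLiftData b).apply_lift _ (coneTransposeRingHom_sigmaRingHom b)
    (coneTransposeRingHom_xiImage b) x).symm

lemma tauHom_injective : Function.Injective (tauHom b) :=
  have htwo : IsUnit (2 : ConeRing V) := by
    rw [← map_ofNat (algebraMap ℂ (ConeRing V)) 2]
    exact (IsUnit.mk0 2 two_ne_zero).map _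
  have : IsDomain (RegSym V) := (SymmetricAlgebra.equivMvPolynomial
    (finBasis ℂ (Dual ℂ (Sym2Tensor V)))).toMulEquiv.isDomain _
  (tauLiftData b).lift_injective (mem_nonZeroDivisors_of_ne_zero (prime_det_mat b).ne_zero)
    htwo.mem_nonZeroDivisors (sigmaRingHom_injective b) (coneTransposeRingHom V)
    (coneTransposeRingHom_sigmaRingHom b) (coneTransposeRingHom_xiImage b)

lemma coneLinear_skewCoord_mem_range (k : Fin 3) :
    coneLinear (skewCoord b k) ∈ (tauHom b).range := by
  have hxi : -Complex.I • xiImage b k = coneLinear (skewCoord b k) := by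
    rw [xiImage, smul_smul, neg_mul, Complex.I_mul_I, neg_neg, one_smul]
  rw [← hxi, ← tauHom_xiCoord]
  exact Subalgebra.smul_mem _ (AlgHom.mem_range_self _ _) _

-- `2 μ_{ij} = (μ_{ij} + μ_{ji}) + (μ_{ij} - μ_{ji})`
lemma tauHom_surjective : Function.Surjective (tauHom b) := by
  rw [← AlgHom.range_eq_top, ← top_le_iff, ← adjoin_range_coneMatrix b, Algebra.adjoin_le_iff]
  rintro _ ⟨⟨i, j⟩, rfl⟩
  let π : Dual ℂ (V ⊗[ℂ] V) →ₗ[ℂ] ConeRing V := ⟨⟨coneLinear, coneLinear_add⟩, coneLinear_smul⟩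
  have hspan : Submodule.span ℂ (Set.range (skewCoord b)) ≤
      (tauHom b).range.toSubmodule.comap π := by
    rw [Submodule.span_le]
    rintro _ ⟨k, rfl⟩
    exact coneLinear_skewCoord_mem_range b k
  have hodd : coneMatrix b i j - coneMatrix b j i ∈ (tauHom b).range := by
    have hmem := hspan (tensorCoord_sub_mem_span_skewCoord b i j)
    rwa [Submodule.mem_comap, map_sub] at hmem
  have heven : coneMatrix b i j + coneMatrix b j i ∈ (tauHom b).range :=
    ⟨_, (tauHom_structureHom b (Ideal.Quotient.mk _ _)).trans
      (congrFun₂ (universalPresentation_mat_map_sigmaRingHom b) i j)⟩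
  have hsum : coneMatrix b i j = (2⁻¹ : ℂ) •
      ((coneMatrix b i j + coneMatrix b j i) + (coneMatrix b i j - coneMatrix b j i)) := by
    module
  change coneMatrix b i j ∈ (tauHom b).range
  rw [hsum]
  exact Subalgebra.smul_mem _ (add_mem heven hodd) _

/-- The isomorphism `τ^*`. -/
def tauEquiv : XRing b ≃ₐ[ℂ] ConeRing V :=
  .ofBijective (tauHom b) ⟨tauHom_injective b, tauHom_surjective b⟩

end Isomorphism

section SmoothLocus

lemma isLocalization_away_of_pow_mul_mem_range {P A : Type*} (L : Type*) [CommRing P] [CommRing A]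
    [CommRing L] [Algebra P A] [Algebra A L] [Algebra P L] [IsScalarTower P A L]
    (hinj : Function.Injective (algebraMap P A)) (x : P)
    (hx : ∀ a : A, ∃ n : ℕ, algebraMap P A x ^ n * a ∈ (algebraMap P A).range)
    [IsLocalization.Away (algebraMap P A x) L] : IsLocalization.Away x L where
  map_units := by
    rintro ⟨_, n, rfl⟩
    have hunit := IsLocalization.Away.algebraMap_isUnit (S := L) (algebraMap P A x)
    rw [← IsScalarTower.algebraMap_apply] at hunit
    simpa only [map_pow] using hunit.pow n
  surj z := by
    obtain ⟨⟨a, _, m, rfl⟩, hz⟩ := IsLocalization.surj (.powers (algebraMap P A x)) z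
    obtain ⟨n, p, hp⟩ := hx a
    refine ⟨(p, ⟨x ^ (n + m), n + m, rfl⟩), ?_⟩
    simp only [IsScalarTower.algebraMap_apply P A L, hp, map_pow, map_mul, pow_add] at hz ⊢
    rw [← hz]
    ring
  exists_of_eq {p p'} h := by
    rw [IsScalarTower.algebraMap_apply P A L, IsScalarTower.algebraMap_apply P A L] at h
    obtain ⟨⟨_, n, rfl⟩, hn⟩ := (IsLocalization.eq_iff_exists (.powers (algebraMap P A x)) L).1 h
    refine ⟨⟨x ^ n, n, rfl⟩, hinj ?_⟩
    simpa only [map_mul, map_pow] using hn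

variable {k : Type*} [CommRing k] {A : Type*} [CommRing A] [Algebra k A]

lemma mem_smoothLocus_of_formallySmooth_away (L : Type*) [CommRing L] [Algebra A L] [Algebra k L]
    [IsScalarTower k A L] [Algebra.FormallySmooth k L] (y : A) [IsLocalization.Away y L]
    {q : PrimeSpectrum A} (hq : y ∉ q.asIdeal) : q ∈ Algebra.smoothLocus k A := by
  have hrange : q ∈ Set.range (PrimeSpectrum.comap (algebraMap A L)) := by
    rw [PrimeSpectrum.localization_away_comap_range L y]
    exact hq
  obtain ⟨q', rfl⟩ := hrange
  rw [← Set.mem_preimage, Algebra.smoothLocus_comap_of_isLocalization y]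
  change Algebra.FormallySmooth k (Localization.AtPrime q'.asIdeal)
  infer_instance

lemma mem_smoothLocus_of_pow_mul_mem_range {P : Type*} [CommRing P] [Algebra k P]
    [Algebra.FormallySmooth k P] (g : P →ₐ[k] A) (hinj : Function.Injective g) (x : P)
    (hx : ∀ a : A, ∃ n : ℕ, g x ^ n * a ∈ g.range) {q : PrimeSpectrum A}
    (hq : g x ∉ q.asIdeal) : q ∈ Algebra.smoothLocus k A := by
  algebraize [g.toRingHom]
  have : IsScalarTower k P A := .of_algHom g
  let L := Localization.Away (g x)
  have : IsLocalization.Away (algebraMap P A x) L := inferInstanceAs (IsLocalization.Away (g x) L)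
  have : IsLocalization.Away x L := isLocalization_away_of_pow_mul_mem_range L hinj x hx
  have : Algebra.FormallySmooth P L := .of_isLocalization (.powers x)
  have : Algebra.FormallySmooth k L := .comp k P L
  exact mem_smoothLocus_of_formallySmooth_away L (g x) hq

lemma comap_mem_smoothLocus_iff {B : Type*} [CommRing B] [Algebra k B] (e : A ≃ₐ[k] B)
    (q : PrimeSpectrum B) :
    PrimeSpectrum.comap (e : A →+* B) q ∈ Algebra.smoothLocus k A ↔
      q ∈ Algebra.smoothLocus k B := by
  algebraize [(e : A →+* B)]
  have : IsScalarTower k A B := .of_algHom (e : A →ₐ[k] B)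
  have : IsLocalization.Away (1 : A) B :=
    IsLocalization.away_of_isUnit_of_bijective B isUnit_one e.bijective
  exact Set.ext_iff.1 (Algebra.smoothLocus_comap_of_isLocalization (R := k) (Af := B) (1 : A)) q

end SmoothLocus

section TangentObstruction

open Polynomial DualNumber

variable {k : Type*} [CommRing k]

lemma aeval_eps (f : k[X]) :
    aeval (ε : k[ε]) f = TrivSqZeroExt.inl (f.coeff 0) + TrivSqZeroExt.inr (f.coeff 1) := by
  have hmod := congrArg (aeval (ε : k[ε])) (divX_mul_X_add f)
  have hmod' := congrArg (aeval (ε : k[ε])) (divX_mul_X_add f.divX)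
  simp only [map_add, map_mul, aeval_X, aeval_C, coeff_divX] at hmod hmod'
  rw [← hmod, ← hmod', add_mul, mul_assoc, eps_mul_eps]
  ext <;> simp [TrivSqZeroExt.algebraMap_eq_inl]

variable (k) in
/-- The projection `k[X]/(X³) → k[ε]` from second order to first order jets. -/
def truncateHom : k[X] ⧸ Ideal.span {(X ^ 3 : k[X])} →ₐ[k] k[ε] :=
  Ideal.Quotient.liftₐ _ (aeval ε) fun f hf => by
    obtain ⟨g, rfl⟩ := Ideal.mem_span_singleton.1 hf
    simp only [map_mul, aeval_X, pow_succ, pow_zero, one_mul, eps_mul_eps, zero_mul]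

lemma truncateHom_mk (f : k[X]) : truncateHom k (Ideal.Quotient.mk _ f) =
    TrivSqZeroExt.inl (f.coeff 0) + TrivSqZeroExt.inr (f.coeff 1) := aeval_eps f

lemma truncateHom_surjective : Function.Surjective (truncateHom k) := fun z =>
  ⟨Ideal.Quotient.mk _ (C z.fst + C z.snd * X), by rw [truncateHom_mk]; ext <;> simp⟩

lemma isNilpotent_ker_truncateHom : IsNilpotent (RingHom.ker (truncateHom k)) := by
  have hker : RingHom.ker (truncateHom k) ≤ Ideal.span {Ideal.Quotient.mk _ (X ^ 2)} := by
    intro z hz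
    obtain ⟨f, rfl⟩ := Ideal.Quotient.mk_surjective z
    rw [RingHom.mem_ker, truncateHom_mk] at hz
    have hcoeff₀ : f.coeff 0 = 0 := by simpa using congrArg TrivSqZeroExt.fst hz
    have hcoeff₁ : f.coeff 1 = 0 := by simpa using congrArg TrivSqZeroExt.snd hz
    rw [Ideal.mem_span_singleton]
    refine map_dvd _ (X_pow_dvd_iff.2 fun d hd => ?_)
    interval_cases d <;> assumption
  refine ⟨2, le_bot_iff.1 ((Ideal.pow_right_mono hker 2).trans ?_)⟩
  rw [Ideal.span_singleton_pow, ← map_pow, Ideal.span_singleton_le_iff_mem, Ideal.mem_bot,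
    Ideal.Quotient.eq_zero_iff_mem, Ideal.mem_span_singleton, ← pow_mul]
  exact pow_dvd_pow X (by norm_num)

variable {A : Type*} [CommRing A] [Algebra k A] {p : Ideal A} [p.IsPrime]

lemma exists_truncateHom_comp_eq_of_isSmoothAt (hp : Algebra.IsSmoothAt k p) (D : A →ₐ[k] k[ε])
    (hD : ∀ a ∉ p, IsUnit (D a).fst) :
    ∃ F : A →ₐ[k] k[X] ⧸ Ideal.span {(X ^ 3 : k[X])}, (truncateHom k).comp F = D := by
  have : Algebra.FormallySmooth k (Localization.AtPrime p) := hp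
  let D' : Localization.AtPrime p →ₐ[k] k[ε] :=
    IsLocalization.liftAlgHom (M := p.primeCompl) (f := D) fun a =>
      TrivSqZeroExt.isUnit_iff_isUnit_fst.2 (hD a a.2)
  let F := Algebra.FormallySmooth.liftOfSurjective D' (truncateHom k) truncateHom_surjective
    isNilpotent_ker_truncateHom
  refine ⟨F.comp (IsScalarTower.toAlgHom k A _), AlgHom.ext fun a => ?_⟩
  rw [AlgHom.comp_apply, AlgHom.comp_apply, Algebra.FormallySmooth.liftOfSurjective_apply]
  exact IsLocalization.lift_eq _ a

-- Compare the coefficients of `X ^ 2` in the relation after lifting `D` to second order.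
lemma snd_mul_snd_eq_of_isSmoothAt (hp : Algebra.IsSmoothAt k p) (D : A →ₐ[k] k[ε])
    (hD : ∀ a ∉ p, IsUnit (D a).fst) {x y z w : A} (hrel : x * y = z * w)
    (hx : (D x).fst = 0) (hy : (D y).fst = 0) (hz : (D z).fst = 0) (hw : (D w).fst = 0) :
    (D x).snd * (D y).snd = (D z).snd * (D w).snd := by
  obtain ⟨F, rfl⟩ := exists_truncateHom_comp_eq_of_isSmoothAt hp D hD
  have hF (a : A) : ∃ f : k[X], Ideal.Quotient.mk _ f = F a ∧
      f.coeff 0 = (truncateHom k (F a)).fst ∧ f.coeff 1 = (truncateHom k (F a)).snd := by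
    obtain ⟨f, hf⟩ := Ideal.Quotient.mk_surjective (F a)
    refine ⟨f, hf, ?_, ?_⟩ <;> rw [← hf, truncateHom_mk] <;> simp
  choose f hf hf₀ hf₁ using hF
  have hmem : f x * f y - f z * f w ∈ Ideal.span {(X ^ 3 : k[X])} := by
    rw [← Ideal.Quotient.eq_zero_iff_mem]
    simp only [map_sub, map_mul, hf]
    rw [← map_mul, ← map_mul, hrel, sub_self]
  have hcoeff := X_pow_dvd_iff.1 (Ideal.mem_span_singleton.1 hmem) 2 (by norm_num)
  simp only [AlgHom.comp_apply, ← hf₀, ← hf₁] at hx hy hz hw ⊢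
  simpa [coeff_mul, Finset.Nat.antidiagonal_succ, hx, hy, hz, hw, sub_eq_zero] using hcoeff

end TangentObstruction

section TangentSpace

open Polynomial DualNumber

variable {W : Type*} [AddCommGroup W] [Module ℂ W]

/-- The `ℂ[ε]`-valued point `ε • E` of `W`: a regular function on `W` is sent to its value and its
derivative in the direction `E` at the origin. -/
def tangentHom (E : W) : Reg W →ₐ[ℂ] ℂ[ε] :=
  SymmetricAlgebra.lift (LinearMap.toSpanSingleton ℂ ℂ[ε] ε ∘ₗ Dual.eval ℂ W E)

lemma tangentHom_ι (E : W) (l : Dual ℂ W) :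
    tangentHom E (SymmetricAlgebra.ι ℂ _ l) = l E • ε := by
  simp [tangentHom]

lemma fst_tangentHom (E : W) (p : Reg W) : (tangentHom E p).fst = evalAt 0 p := by
  have hcomp : (TrivSqZeroExt.fstHom ℂ ℂ ℂ).comp (tangentHom E) = evalAt 0 := by
    apply SymmetricAlgebra.algHom_ext
    ext l
    simp [tangentHom_ι, evalAt]
  exact DFunLike.congr_fun hcomp p

lemma snd_tangentHom_add (E E' : W) (p : Reg W) :
    (tangentHom (E + E') p).snd = (tangentHom E p).snd + (tangentHom E' p).snd := by
  induction p using SymmetricAlgebra.induction with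
  | algebraMap r => simp [AlgHom.commutes, TrivSqZeroExt.algebraMap_eq_inl]
  | mul x y hx hy =>
    simp only [map_mul, TrivSqZeroExt.snd_mul, hx, hy, fst_tangentHom, smul_add]
    abel
  | add x y hx hy => simp only [map_add, TrivSqZeroExt.snd_add, hx, hy, add_add_add_comm]
  | ι l => simp [tangentHom_ι]

/-- The restriction of regular functions on `W` to the line `s ↦ s • w`. -/
def lineHom (w : W) : Reg W →ₐ[ℂ] ℂ[X] :=
  SymmetricAlgebra.lift (LinearMap.toSpanSingleton ℂ ℂ[X] X ∘ₗ Dual.eval ℂ W w)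

lemma eval_lineHom (w : W) (s : ℂ) (p : Reg W) : (lineHom w p).eval s = evalAt (s • w) p := by
  have hcomp : (aeval s).comp (lineHom w) = evalAt (s • w) := by
    apply SymmetricAlgebra.algHom_ext
    ext l
    simp [lineHom, evalAt, mul_comm]
  rw [← coe_aeval_eq_eval]
  exact DFunLike.congr_fun hcomp p

lemma aeval_eps_lineHom (w : W) (p : Reg W) : aeval ε (lineHom w p) = tangentHom w p := by
  have hcomp : (aeval ε).comp (lineHom w) = tangentHom w := by
    apply SymmetricAlgebra.algHom_ext
    ext l <;> simp [lineHom, tangentHom_ι]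
  exact DFunLike.congr_fun hcomp p

variable {Z : Set W} {p : Reg W}

lemma tangentHom_eq_zero_of_mem (hZ : ∀ s : ℂ, ∀ w ∈ Z, s • w ∈ Z) {w : W} (hw : w ∈ Z)
    (hp : p ∈ idealOf Z) : tangentHom w p = 0 := by
  have hline : lineHom w p = 0 := Polynomial.funext fun s => by
    rw [eval_zero, eval_lineHom]
    exact mem_idealOf.1 hp _ (hZ s w hw)
  rw [← aeval_eps_lineHom, hline, map_zero]

lemma tangentHom_eq_zero_of_mem_span (hZ : ∀ s : ℂ, ∀ w ∈ Z, s • w ∈ Z) (hne : Z.Nonempty)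
    {E : W} (hE : E ∈ Submodule.span ℂ Z) (hp : p ∈ idealOf Z) : tangentHom E p = 0 := by
  induction hE using Submodule.closure_induction with
  | zero =>
    obtain ⟨w, hw⟩ := hne
    exact tangentHom_eq_zero_of_mem hZ (zero_smul ℂ w ▸ hZ 0 w hw) hp
  | add E E' _ _ hE hE' =>
    ext
    · rw [fst_tangentHom, ← fst_tangentHom E, hE]
    · rw [snd_tangentHom_add, hE, hE', TrivSqZeroExt.snd_zero, add_zero]
  | smul_mem s w hw => exact tangentHom_eq_zero_of_mem hZ (hZ s w hw) hp

end TangentSpace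

section SingularLocus

open DualNumber

variable {V : Type*} [AddCommGroup V] [Module ℂ V] {ι : Type*}

variable (V) in
/-- The origin of `(V ⊗ V)_1`. -/
def coneOrigin : PrimeSpectrum (ConeRing V) := conePoint 0 zero_mem_rankOneCone

lemma mem_coneOrigin {x : ConeRing V} :
    x ∈ (coneOrigin V).asIdeal ↔ coneEval 0 zero_mem_rankOneCone x = 0 := Iff.rfl

lemma sub_algebraMap_coneEval_zero_mem [Finite ι] (b : Basis ι ℂ V) {I : Ideal (ConeRing V)}
    (hI : ∀ i j, coneMatrix b i j ∈ I) (x : ConeRing V) :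
    x - algebraMap ℂ _ (coneEval 0 zero_mem_rankOneCone x) ∈ I := by
  have hcomp : Ideal.Quotient.mkₐ ℂ I =
      (Algebra.ofId ℂ _).comp (coneEval 0 zero_mem_rankOneCone) := by
    refine AlgHom.ext_of_adjoin_eq_top (adjoin_range_coneMatrix b) ?_
    rintro _ ⟨⟨i, j⟩, rfl⟩
    have hzero : coneEval 0 zero_mem_rankOneCone (coneMatrix b i j) = 0 := by
      rw [coneMatrix_apply, coneEval_coneLinear, map_zero]
    change Ideal.Quotient.mk I (coneMatrix b i j) =
      Algebra.ofId ℂ _ (coneEval 0 zero_mem_rankOneCone (coneMatrix b i j))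
    rw [hzero, map_zero, Ideal.Quotient.eq_zero_iff_mem.2 (hI i j)]
  exact Ideal.Quotient.eq.1 (DFunLike.congr_fun hcomp x)

lemma eq_coneOrigin [Finite ι] (b : Basis ι ℂ V) {q : PrimeSpectrum (ConeRing V)}
    (hq : ∀ i j, coneMatrix b i j ∈ q.asIdeal) : q = coneOrigin V := by
  have hmem := sub_algebraMap_coneEval_zero_mem b hq
  ext x
  rw [mem_coneOrigin]
  constructor
  · intro hx
    by_contra hne
    have hconst : algebraMap ℂ (ConeRing V) (coneEval 0 zero_mem_rankOneCone x) ∈ q.asIdeal := by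
      simpa only [sub_sub_cancel] using sub_mem hx (hmem x)
    exact q.2.ne_top (q.asIdeal.eq_top_of_isUnit_mem hconst ((isUnit_iff_ne_zero.2 hne).map _))
  · intro hx
    simpa only [hx, map_zero, sub_zero] using hmem x

lemma span_rankOneCone : Submodule.span ℂ (rankOneCone V) = ⊤ := by
  rw [eq_top_iff, ← TensorProduct.span_tmul_eq_top]
  refine Submodule.span_mono ?_
  rintro _ ⟨v, w, rfl⟩
  exact tmul_mem_rankOneCone v w

section Chart

/-- The subalgebra of functions on `(V ⊗ V)_1` generated by the `i`-th row and the `j`-th column of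
the generic matrix, as the image of a polynomial ring; these are coordinates where
`μ_{ij} ≠ 0`. -/
def chartHom (b : Basis ι ℂ V) (i j : ι) :
    MvPolynomial {q : ι × ι // q.1 = i ∨ q.2 = j} ℂ →ₐ[ℂ] ConeRing V :=
  MvPolynomial.aeval fun q => coneMatrix b q.1.1 q.1.2

variable (b : Basis ι ℂ V) (i j : ι)

lemma coneMatrix_row_mem_range_chartHom (l : ι) : coneMatrix b i l ∈ (chartHom b i j).range :=
  ⟨.X ⟨(i, l), .inl rfl⟩, MvPolynomial.aeval_X _ _⟩

lemma coneMatrix_col_mem_range_chartHom (k : ι) : coneMatrix b k j ∈ (chartHom b i j).range :=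
  ⟨.X ⟨(k, j), .inr rfl⟩, MvPolynomial.aeval_X _ _⟩

-- A polynomial killed by `chartHom` vanishes at the row and column of every tensor
-- `v ⊗ w`, and all values `c` with `c_{ij} ≠ 0` arise in this way.
lemma chartHom_injective [Finite ι] : Function.Injective (chartHom b i j) := by
  refine (injective_iff_map_eq_zero _).2 fun p hp => ?_
  let q₀ : {q : ι × ι // q.1 = i ∨ q.2 = j} := ⟨(i, j), .inl rfl⟩
  suffices hmul : MvPolynomial.X q₀ * p = 0 from
    (mul_eq_zero.1 hmul).resolve_left (MvPolynomial.X_ne_zero q₀)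
  refine MvPolynomial.funext fun c => ?_
  rw [map_mul, MvPolynomial.eval_X, map_zero]
  rcases eq_or_ne (c q₀) 0 with hc | hc
  · rw [hc, zero_mul]
  let v := b.equivFun.symm fun k => c ⟨(k, j), .inr rfl⟩
  let w := b.equivFun.symm fun l => c ⟨(i, l), .inl rfl⟩ / c q₀
  have hv (k : ι) : b.repr v k = c ⟨(k, j), .inr rfl⟩ :=
    congrFun (b.equivFun.apply_symm_apply _) k
  have hw (l : ι) : b.repr w l = c ⟨(i, l), .inl rfl⟩ / c q₀ :=
    congrFun (b.equivFun.apply_symm_apply _) l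
  have hcomp : (coneEval _ (tmul_mem_rankOneCone v w)).comp (chartHom b i j) =
      MvPolynomial.aeval c := by
    apply MvPolynomial.algHom_ext
    rintro ⟨⟨k, l⟩, rfl | rfl⟩ <;>
      rw [AlgHom.comp_apply, chartHom, MvPolynomial.aeval_X, MvPolynomial.aeval_X,
        coneMatrix_apply, coneEval_coneLinear, tensorCoord_tmul, hv, hw]
    · exact mul_div_cancel₀ _ hc
    · exact (congrArg _ (div_self hc)).trans (mul_one _)
  have heval := DFunLike.congr_fun hcomp p
  rw [AlgHom.comp_apply, hp, map_zero] at heval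
  exact mul_eq_zero_of_right _ heval.symm

-- `μ_{ij} μ_{kl} = μ_{il} μ_{kj}`
lemma exists_coneMatrix_pow_mul_mem_range_chartHom [FiniteDimensional ℂ V]
    (x : ConeRing V) : ∃ n : ℕ, coneMatrix b i j ^ n * x ∈ (chartHom b i j).range := by
  have := Module.Finite.finite_basis b
  have hij := coneMatrix_row_mem_range_chartHom b i j j
  have hx : x ∈ Algebra.adjoin ℂ (Set.range fun q : ι × ι => coneMatrix b q.1 q.2) := by
    rw [adjoin_range_coneMatrix]
    trivial
  induction hx using Algebra.adjoin_induction with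
  | mem x hx =>
    obtain ⟨⟨k, l⟩, rfl⟩ := hx
    refine ⟨1, ?_⟩
    rw [pow_one, coneMatrix_mul_coneMatrix]
    exact mul_mem (coneMatrix_row_mem_range_chartHom b i j l)
      (coneMatrix_col_mem_range_chartHom b i j k)
  | algebraMap r => exact ⟨0, mul_mem (pow_mem hij 0) (Subalgebra.algebraMap_mem _ r)⟩
  | add x y _ _ hx hy =>
    obtain ⟨n, hn⟩ := hx
    obtain ⟨m, hm⟩ := hy
    refine ⟨m + n, ?_⟩
    rw [mul_add, pow_add, mul_assoc, mul_right_comm, mul_comm _ (_ ^ n)]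
    exact add_mem (mul_mem (pow_mem hij m) hn) (mul_mem (pow_mem hij n) hm)
  | mul x y _ _ hx hy =>
    obtain ⟨n, hn⟩ := hx
    obtain ⟨m, hm⟩ := hy
    refine ⟨n + m, ?_⟩
    rw [pow_add, mul_mul_mul_comm]
    exact mul_mem hn hm

lemma mem_smoothLocus_of_coneMatrix_notMem [FiniteDimensional ℂ V]
    {q : PrimeSpectrum (ConeRing V)} (hq : coneMatrix b i j ∉ q.asIdeal) :
    q ∈ Algebra.smoothLocus ℂ (ConeRing V) := by
  have := Module.Finite.finite_basis b
  have hX : chartHom b i j (.X ⟨(i, j), .inl rfl⟩) = coneMatrix b i j := MvPolynomial.aeval_X _ _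
  refine mem_smoothLocus_of_pow_mul_mem_range (chartHom b i j) (chartHom_injective b i j)
    (.X ⟨(i, j), .inl rfl⟩) ?_ ?_ <;> rw [hX]
  exacts [exists_coneMatrix_pow_mul_mem_range_chartHom b i j, hq]

end Chart

variable [FiniteDimensional ℂ V]

lemma smul_mem_rankOneCone (s : ℂ) (μ : V ⊗[ℂ] V) (hμ : μ ∈ rankOneCone V) :
    s • μ ∈ rankOneCone V := by
  obtain ⟨v, w, rfl⟩ := mem_rankOneCone_iff.1 hμ
  exact tmul_mem_rankOneCone (s • v) w

/-- The tangent vector of `(V ⊗ V)_1` at the origin given by an arbitrary tensor: the cone spans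
`V ⊗ V`, so its tangent space at the origin is all of it. -/
def coneTangentHom (E : V ⊗[ℂ] V) : ConeRing V →ₐ[ℂ] ℂ[ε] :=
  Ideal.Quotient.liftₐ _ (tangentHom E) fun _ hp =>
    tangentHom_eq_zero_of_mem_span smul_mem_rankOneCone ⟨0, zero_mem_rankOneCone⟩
      (span_rankOneCone.ge Submodule.mem_top) hp

lemma coneTangentHom_coneMatrix (b : Basis ι ℂ V) (E : V ⊗[ℂ] V) (i j : ι) :
    coneTangentHom E (coneMatrix b i j) = tensorCoord b i j E • ε :=
  tangentHom_ι E _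

lemma fst_coneTangentHom (E : V ⊗[ℂ] V) (x : ConeRing V) :
    (coneTangentHom E x).fst = coneEval 0 zero_mem_rankOneCone x := by
  obtain ⟨p, rfl⟩ := Ideal.Quotient.mk_surjective x
  exact fst_tangentHom E p

-- The relation `μ_{ii} μ_{jj} = μ_{ij} μ_{ji}` fails to second order along the tangent vector
-- `b_i ⊗ b_i + b_j ⊗ b_j`.
lemma coneOrigin_notMem_smoothLocus [Nontrivial ι] (b : Basis ι ℂ V) :
    coneOrigin V ∉ Algebra.smoothLocus ℂ (ConeRing V) := by
  intro hsmooth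
  obtain ⟨i, j, hij⟩ := exists_pair_ne ι
  let D := coneTangentHom (b i ⊗ₜ[ℂ] b i + b j ⊗ₜ[ℂ] b j)
  have hunit (a) (ha : a ∉ (coneOrigin V).asIdeal) : IsUnit (D a).fst := by
    rw [fst_coneTangentHom]
    exact isUnit_iff_ne_zero.2 (mt mem_coneOrigin.2 ha)
  have hfst (k l : ι) : (D (coneMatrix b k l)).fst = 0 := by
    simp [D, coneTangentHom_coneMatrix]
  have hsnd := snd_mul_snd_eq_of_isSmoothAt hsmooth D hunit
    (coneMatrix_mul_coneMatrix b i i j j) (hfst i i) (hfst j j) (hfst i j) (hfst j i)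
  simp [D, coneTangentHom_coneMatrix, tensorCoord_tmul, hij, hij.symm] at hsnd

lemma compl_smoothLocus_coneRing [Nontrivial ι] (b : Basis ι ℂ V) :
    (Algebra.smoothLocus ℂ (ConeRing V))ᶜ = {coneOrigin V} := by
  have := Module.Finite.finite_basis b
  refine Set.eq_singleton_iff_unique_mem.2 ⟨coneOrigin_notMem_smoothLocus b, fun q hq => ?_⟩
  refine eq_coneOrigin b fun i j => ?_
  by_contra hij
  exact hq (mem_smoothLocus_of_coneMatrix_notMem b i j hij)

end SingularLocus

section Schemes

variable {V : Type*} [AddCommGroup V] [Module ℂ V] [FiniteDimensional ℂ V] (b : Basis (Fin 3) ℂ V)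

lemma comap_sigmaRingHom_coneOrigin :
    PrimeSpectrum.comap (sigmaRingHom b) (coneOrigin V) = yPoint b 0 zero_mem_degenerate := by
  refine PrimeSpectrum.ext (Ideal.ext fun r => ?_)
  obtain ⟨p, rfl⟩ := Ideal.Quotient.mk_surjective r
  change coneEval 0 zero_mem_rankOneCone (sigmaRingHom b (Ideal.Quotient.mk _ p)) = 0 ↔
    evalAt 0 p = 0
  rw [coneEval_sigmaRingHom, map_zero]

lemma coneMatrix_add_transpose_mem_of_comap_sigmaRingHom {q : PrimeSpectrum (ConeRing V)}
    (hq : PrimeSpectrum.comap (sigmaRingHom b) q = yPoint b 0 zero_mem_degenerate) (i j : Fin 3) :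
    coneMatrix b i j + coneMatrix b j i ∈ q.asIdeal := by
  have hmat : Ideal.Quotient.mk _ ((universalPresentation b).mat i j) ∈
      (yPoint b 0 zero_mem_degenerate).asIdeal := by
    change evalAt (0 : Sym2Tensor V) ((universalPresentation b).mat i j) = 0
    rw [universalPresentation_mat_apply, evalAt_ι, map_zero]
  have hentry : sigmaRingHom b (Ideal.Quotient.mk _ ((universalPresentation b).mat i j)) =
      coneMatrix b i j + coneMatrix b j i :=
    congrFun₂ (universalPresentation_mat_map_sigmaRingHom b) i j
  rw [← hq] at hmat
  rwa [← hentry]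

-- `μ_{ij}² = μ_{ij} (μ_{ij} + μ_{ji}) - μ_{ii} μ_{jj}`
lemma eq_coneOrigin_of_comap_sigmaRingHom {q : PrimeSpectrum (ConeRing V)}
    (hq : PrimeSpectrum.comap (sigmaRingHom b) q = yPoint b 0 zero_mem_degenerate) :
    q = coneOrigin V := by
  have hsum := coneMatrix_add_transpose_mem_of_comap_sigmaRingHom b hq
  have hdiag (i : Fin 3) : coneMatrix b i i ∈ q.asIdeal := by
    have hhalf : coneMatrix b i i = (2⁻¹ : ℂ) • (coneMatrix b i i + coneMatrix b i i) := by module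
    rw [hhalf]
    exact Submodule.smul_of_tower_mem q.asIdeal _ (hsum i i)
  refine eq_coneOrigin b fun i j => q.2.mem_of_pow_mem 2 ?_
  have hsq : coneMatrix b i j ^ 2 = coneMatrix b i j * (coneMatrix b i j + coneMatrix b j i) -
      coneMatrix b i i * coneMatrix b j j := by
    rw [coneMatrix_mul_coneMatrix b i i j j]
    ring
  rw [hsq]
  exact sub_mem (q.asIdeal.mul_mem_left _ (hsum i j)) (q.asIdeal.mul_mem_left _ (hdiag j))

/-- The isomorphism `τ : (V ⊗ V)_1 ≅ X(V)`. -/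
def tauIso : ConeScheme V ≅ XScheme b :=
  Scheme.Spec.mapIso (tauEquiv b).toRingEquiv.toCommRingCatIso.op

lemma tauIso_hom : (tauIso b).hom = Spec.map (CommRingCat.ofHom
    ((tauEquiv b : XRing b ≃ₐ[ℂ] ConeRing V) : XRing b →+* ConeRing V)) :=
  rfl

lemma tauIso_hom_coverMap : (tauIso b).hom ≫ coverMap b = sigmaMap b := by
  rw [tauIso_hom, coverMap, sigmaMap, ← Spec.map_comp, ← CommRingCat.ofHom_comp]
  congr 2
  exact RingHom.ext (tauHom_structureHom b)

lemma tauIso_hom_coverInvolution :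
    (tauIso b).hom ≫ coverInvolution b = coneTranspose V ≫ (tauIso b).hom := by
  rw [tauIso_hom, coverInvolution, coneTranspose, ← Spec.map_comp, ← Spec.map_comp,
    ← CommRingCat.ofHom_comp, ← CommRingCat.ofHom_comp]
  congr 2
  exact RingHom.ext (tauHom_involution b)

lemma tauIso_hom_bijective : Function.Bijective (tauIso b).hom :=
  (tauIso b).hom.homeomorph.bijective

lemma coverMap_tauIso_hom_apply (q : ConeScheme V) :
    coverMap b ((tauIso b).hom q) = PrimeSpectrum.comap (sigmaRingHom b) q := by
  rw [← Scheme.Hom.comp_apply, tauIso_hom_coverMap]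
  rfl

lemma singularLocus_eq :
    singularLocus b = {(tauIso b).hom (conePoint 0 zero_mem_rankOneCone)} := by
  ext x
  obtain ⟨q, rfl⟩ := (tauIso_hom_bijective b).surjective x
  calc (tauIso b).hom q ∈ singularLocus b
    _ ↔ q ∈ (Algebra.smoothLocus ℂ (ConeRing V))ᶜ :=
      not_congr (comap_mem_smoothLocus_iff (tauEquiv b) q)
    _ ↔ q = coneOrigin V := Set.ext_iff.1 (compl_smoothLocus_coneRing b) q
    _ ↔ (tauIso b).hom q = (tauIso b).hom (coneOrigin V) :=
      (tauIso_hom_bijective b).injective.eq_iff.symm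

lemma coverMap_preimage_yPoint_zero :
    coverMap b ⁻¹' {yPoint b 0 zero_mem_degenerate} =
      {(tauIso b).hom (conePoint 0 zero_mem_rankOneCone)} := by
  ext x
  obtain ⟨q, rfl⟩ := (tauIso_hom_bijective b).surjective x
  calc coverMap b ((tauIso b).hom q) = yPoint b 0 zero_mem_degenerate
    _ ↔ PrimeSpectrum.comap (sigmaRingHom b) q = yPoint b 0 zero_mem_degenerate :=
      (coverMap_tauIso_hom_apply b q).congr_left
    _ ↔ q = coneOrigin V :=
      ⟨eq_coneOrigin_of_comap_sigmaRingHom b, fun h => h ▸ comap_sigmaRingHom_coneOrigin b⟩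
    _ ↔ (tauIso b).hom q = (tauIso b).hom (coneOrigin V) :=
      (tauIso_hom_bijective b).injective.eq_iff.symm

end Schemes

end

theorem mainTheorem11 {V : Type*} [AddCommGroup V] [Module ℂ V] [FiniteDimensional ℂ V]
    (b : Module.Basis (Fin 3) ℂ V) :
    idealOf (degenerate V) = (universalPresentation b).fitt ∧
    ∃ τ : ConeScheme V ≅ XScheme b,
      τ.hom ≫ coverMap b = sigmaMap b ∧
      τ.hom ≫ coverInvolution b = coneTranspose V ≫ τ.hom ∧
      (∃ e : XRing b ≃ₐ[ℂ] ConeRing V,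
        τ.hom = Spec.map (CommRingCat.ofHom (e : XRing b →+* ConeRing V)) ∧
        ∀ k : Fin 3, e (xiCoord b k) = Complex.I • coneLinear (skewCoord b k)) ∧
      singularLocus b = {τ.hom (conePoint 0 zero_mem_rankOneCone)} ∧
      coverMap b ⁻¹' {yPoint b 0 zero_mem_degenerate} =
        {τ.hom (conePoint 0 zero_mem_rankOneCone)} :=
  ⟨idealOf_degenerate b, tauIso b, tauIso_hom_coverMap b, tauIso_hom_coverInvolution b,
    ⟨tauEquiv b, tauIso_hom b, tauHom_xiCoord b⟩, singularLocus_eq b,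
    coverMap_preimage_yPoint_zero b⟩
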